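/- Rings are associative with $1$, a domain is a not necessarily commutative nonzero ring without zero divisors, and modules are left modules. A unary pp formula $\varphi(x)$ over a ring $R$ has the form $\exists \bar y\,(A\bar y = \bar b\,x)$ with $A$ an $m\times k$ matrix and $\bar b$ a column of length $m$ over $R$; it defines the subgroup $\varphi(M)=\{a\in M : A\bar y=\bar b\,a \text{ for some } \bar y\in M^k\}$ of every $R$-module $M$. A submodule $A\subseteq M$ is pure if $\varphi(A)=A\cap\varphi(M)$ for all unary pp formulas $\varphi$, and relatively divisible if $rA=A\cap rM$ for all $r\in R$; $R$ is an RD ring if these two notions agree for all submodules of all $R$-modules. A module is absolutely pure if it is pure in every module containing it, and pure injective if it is injective with respect to pure embeddings. The formula $\varphi$ is high if $\varphi(E)=E$ for every absolutely pure module $E$. The first Ulm submodule $\mathfrak u(M)$ is the intersection of the subgroups $\varphi(M)$, $\varphi$ high (it is a submodule). Put $\mathfrak u^0(M)=M$, $\mathfrak u^{\alpha+1}(M)=\mathfrak u(\mathfrak u^\alpha(M))$, and $\mathfrak u^\delta(M)=\bigcap_{\alpha<\delta}\mathfrak u^\alpha(M)$ for limit ordinals $\delta$; the last Ulm submodule is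 $\mathfrak u^\infty(M)=\mathfrak u^\tau(M)$, where $\tau$ is the least ordinal with $\mathfrak u^{\tau+1}(M)=\mathfrak u^\tau(M)$. Corollary. (1) Let $N$ be a pure injective module over an RD domain. Then $\mathfrak u(N)$ is injective, there is a submodule $N_r$ of $N$ with $N=\mathfrak u(N)\oplus N_r$ and $\mathfrak u(N_r)=0$, one has $\mathfrak u(N)=\mathfrak u^\infty(N)$, and $\mathfrak u(N)$ is the largest injective submodule of $N$ (it is injective and contains every injective submodule of $N$). (2) This applies to the first Weyl algebra: for every field $k$ of characteristic $0$, the algebra $k\langle x,\partial\rangle/(\partial x-x\partial-1)$ is an RD domain. -/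

import Mathlib

universe u v w

/-- A unary positive primitive formula `∃ y, A y = b x` for left `R`-modules, where `A` is an
`m × k` matrix over `R`, `b` a column of length `m` and `y` a column of `k` variables. -/
structure PPFormula (R : Type u) where
  numVars : ℕ
  numEqs : ℕ
  A : Matrix (Fin numEqs) (Fin numVars) R
  b : Fin numEqs → R

namespace PPFormula

variable {R : Type u} [Ring R]

/-- The pp subgroup `φ(M)` defined by the pp formula `φ` in the left `R`-module `M`. -/
def eval (φ : PPFormula R) (M : Type w) [AddCommGroup M] [Module R M] : AddSubgroup M where
  carrier := {x | ∃ y : Fin φ.numVars → M, ∀ i, ∑ j, φ.A i j • y j = φ.b i • x}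
  zero_mem' := ⟨0, by simp⟩
  add_mem' := by
    rintro x x' ⟨y, hy⟩ ⟨y', hy'⟩
    exact ⟨y + y', fun i => by simp [Finset.sum_add_distrib, hy, hy']⟩
  neg_mem' := by
    rintro x ⟨y, hy⟩
    exact ⟨-y, fun i => by simp [hy]⟩

/-- The formula `r⁻¹φ`, i.e. `φ(r x)`. -/
def inv (r : R) (φ : PPFormula R) : PPFormula R where
  numVars := φ.numVars
  numEqs := φ.numEqs
  A := φ.A
  b := fun i => φ.b i * r

theorem mem_eval_inv (r : R) (φ : PPFormula R) (M : Type w) [AddCommGroup M] [Module R M]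
    (x : M) : x ∈ (φ.inv r).eval M ↔ r • x ∈ φ.eval M := by
  change (∃ y : Fin φ.numVars → M, ∀ i, ∑ j, φ.A i j • y j = (φ.b i * r) • x) ↔
    (∃ y : Fin φ.numVars → M, ∀ i, ∑ j, φ.A i j • y j = φ.b i • r • x)
  simp only [mul_smul]

end PPFormula

section

variable {R : Type u} [Ring R]

/-- The submodule `A` of `M` is pure in `M`: `A ∩ φ(M) = φ(A)` for every unary pp formula `φ`
(the inclusion `φ(A) ⊆ A ∩ φ(M)` always holds). -/
def IsPureSubmodule {M : Type w} [AddCommGroup M] [Module R M] (A : Submodule R M) : Prop :=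
  ∀ (φ : PPFormula R) (a : A), (a : M) ∈ φ.eval M → a ∈ φ.eval A

/-- The submodule `A` of `M` is relatively divisible in `M`: `A ∩ rM = rA` for every `r`. -/
def IsRDSubmodule {M : Type w} [AddCommGroup M] [Module R M] (A : Submodule R M) : Prop :=
  ∀ (r : R) (a : A), (∃ m : M, r • m = a) → ∃ a' : A, r • a' = a

variable (R)

/-- An RD ring is a ring over which purity of submodules is the same as relative divisibility. -/
def IsRDRing : Prop :=
  ∀ (M : Type w) [AddCommGroup M] [Module R M] (A : Submodule R M),
    IsPureSubmodule A ↔ IsRDSubmodule A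

/-- A module is absolutely pure if it is pure in every module that contains it. -/
def IsAbsolutelyPure (E : Type w) [AddCommGroup E] [Module R E] : Prop :=
  ∀ (M : Type w) [AddCommGroup M] [Module R M] (f : E →ₗ[R] M), Function.Injective f →
    IsPureSubmodule (LinearMap.range f)

/-- A module is pure injective if it is injective with respect to pure embeddings. -/
def IsPureInjective (N : Type w) [AddCommGroup N] [Module R N] : Prop :=
  ∀ (M : Type w) [AddCommGroup M] [Module R M] (A : Submodule R M), IsPureSubmodule A →
    ∀ f : A →ₗ[R] N, ∃ g : M →ₗ[R] N, ∀ a : A, g a = f a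

variable {R}

/-- A unary pp formula `φ` is high if `φ(E) = E` for every absolutely pure module `E`. -/
def PPFormula.IsHigh (φ : PPFormula R) : Prop :=
  ∀ (E : Type w) [AddCommGroup E] [Module R E], IsAbsolutelyPure R E → φ.eval E = ⊤

theorem PPFormula.IsHigh.inv {φ : PPFormula R} (h : PPFormula.IsHigh.{u, w} φ) (r : R) :
    PPFormula.IsHigh.{u, w} (φ.inv r) := by
  intro E _ _ hE
  refine eq_top_iff.2 fun x _ => ?_
  rw [PPFormula.mem_eval_inv, h E hE]
  trivial

variable (R)

/-- The (first) Ulm submodule `u(M)`: the intersection of all high subgroups `φ(M)` of `M`. -/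
def ulm (M : Type w) [AddCommGroup M] [Module R M] : Submodule R M where
  carrier := {x | ∀ φ : PPFormula R, PPFormula.IsHigh.{u, w} φ → x ∈ φ.eval M}
  zero_mem' := fun φ _ => (φ.eval M).zero_mem
  add_mem' := fun hx hy φ hφ => (φ.eval M).add_mem (hx φ hφ) (hy φ hφ)
  smul_mem' := fun r x hx φ hφ => (φ.mem_eval_inv r M x).1 (hx _ (hφ.inv r))

/-- The Ulm sequence of `M`, all of whose terms are regarded as submodules of `M`:
`u⁰(M) = M`, `u^(α+1)(M) = u(u^α(M))`, and `u^δ(M) = ⋂_{α<δ} u^α(M)` for `δ` a limit. -/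
noncomputable def ulmSeq (M : Type w) [AddCommGroup M] [Module R M] (α : Ordinal.{w}) :
    Submodule R M :=
  Ordinal.limitRecOn α ⊤ (fun _ U => (ulm R U).map U.subtype)
    (fun δ _ ih => ⨅ β : Set.Iio δ, ih β.1 β.2)

/-- The Ulm length of `M`: the smallest `τ` with `u^(τ+1)(M) = u^τ(M)`. -/
noncomputable def ulmLength (M : Type w) [AddCommGroup M] [Module R M] : Ordinal.{w} :=
  sInf {τ | ulmSeq R M (τ + 1) = ulmSeq R M τ}

/-- The last Ulm submodule of `M`, i.e. the last term of its Ulm sequence. -/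
noncomputable def lastUlm (M : Type w) [AddCommGroup M] [Module R M] : Submodule R M :=
  ulmSeq R M (ulmLength R M)

section

variable (M : Type w) [AddCommGroup M] [Module R M]

theorem ulmSeq_zero : ulmSeq R M 0 = ⊤ := by
  simp [ulmSeq]

theorem ulmSeq_add_one (α : Ordinal.{w}) :
    ulmSeq R M (α + 1) =
      (ulm R (ulmSeq R M α)).map (ulmSeq R M α).subtype :=
  Ordinal.limitRecOn_add_one α _ _ _

theorem ulmSeq_limit {δ : Ordinal.{w}} (h : Order.IsSuccLimit δ) :
    ulmSeq R M δ = ⨅ β : Set.Iio δ, ulmSeq R M β := by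
  simp only [ulmSeq]
  rw [Ordinal.limitRecOn_limit _ _ _ _ h]

theorem ulmSeq_antitone : Antitone (ulmSeq R M) := by
  intro α β
  induction β using Ordinal.limitRecOn with
  | zero => intro h; rw [le_antisymm h zero_le]
  | add_one β ih =>
    intro h
    rcases h.lt_or_eq with h | rfl
    · refine le_trans ?_ (ih (Order.lt_succ_iff.1 h))
      rw [ulmSeq_add_one]
      exact Submodule.map_subtype_le _ _
    · exact le_rfl
  | limit δ hδ ih =>
    intro h
    rcases h.lt_or_eq with h | rfl
    · rw [ulmSeq_limit R M hδ]
      exact iInf_le (fun β : Set.Iio δ => ulmSeq R M β) ⟨α, h⟩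
    · exact le_rfl

/-- The Ulm sequence becomes stationary, so that the Ulm length is well defined. -/
theorem ulmSeq_ulmLength_add_one :
    ulmSeq R M (ulmLength R M + 1) = ulmSeq R M (ulmLength R M) := by
  have hne : {τ | ulmSeq R M (τ + 1) = ulmSeq R M τ}.Nonempty := by
    by_contra hcon
    rw [Set.not_nonempty_iff_eq_empty, Set.eq_empty_iff_forall_notMem] at hcon
    refine not_injective_of_ordinal (ulmSeq R M) fun α β hαβ => ?_
    rcases lt_trichotomy α β with h | h | h
    · exact (hcon α (le_antisymm (ulmSeq_antitone R M (Order.le_succ α))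
        (hαβ.le.trans (ulmSeq_antitone R M (Order.succ_le_of_lt h))))).elim
    · exact h
    · exact (hcon β (le_antisymm (ulmSeq_antitone R M (Order.le_succ β))
        (hαβ.ge.trans (ulmSeq_antitone R M (Order.succ_le_of_lt h))))).elim
  exact csInf_mem hne

end

end

/-- The defining relation `∂ x = x ∂ + 1` of the first Weyl algebra; the generators `0` and `1` of
the free algebra are `x` and `∂`. -/
inductive WeylRel (k : Type u) [Field k] : FreeAlgebra k (Fin 2) → FreeAlgebra k (Fin 2) → Prop
  | comm : WeylRel k (FreeAlgebra.ι k 1 * FreeAlgebra.ι k 0)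
      (FreeAlgebra.ι k 0 * FreeAlgebra.ι k 1 + 1)

/-- The first Weyl algebra `k⟨x, ∂⟩ / (∂ x - x ∂ - 1)` over the field `k`. -/
abbrev WeylAlgebra (k : Type u) [Field k] : Type u :=
  RingQuot (WeylRel k)

/-! Part (1). Embed `R` in an injective module `E` and let `e` be the image of `1`. A pp formula
true of `e` is high: in the pushout of `E` and an absolutely pure module `D` along `e ↦ d`, the
formula holds at `d`, hence already in `D`. So an element `a` of `u(N)` satisfies every pp formula
that `e` satisfies. This makes `N` pure in the pushout along `e ↦ a`, and pure injectivity gives a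
map `E → N` with `e ↦ a` (`exists_linearMap_of_mem_ulm`). Over a domain `E` is divisible, and its
image lies in `u(N)`, so `u(N)` is divisible. Over an RD ring a divisible module is absolutely pure.
Hence `u(N)` is pure in an injective module, and pure injectivity of `N` makes it a retract of that
module (`ulm_injective`). The remaining claims of part (1) follow because linear maps preserve Ulm
submodules and `u(E) = E` for absolutely pure `E`.

Part (2). Let `R` be a simple domain, noetherian on both sides and left hereditary, whose quotients
by nonzero principal one-sided ideals are artinian. A finitely generated module is then a projective
plus a torsion module, and the torsion part is cyclic, say `R/I`. The same cyclicity for right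
modules, applied to `Hom(I, R)/R`, shows that `R/I` is a summand of some `R/Rb`
(`exists_sub_mul_mem_span`). Relative divisibility is exactly what lifts maps from `R/Rb`, so it
implies purity (`isRDRing_of_isSimpleRing`).

For the Weyl algebra these properties come from localizing at the nonzero polynomials in `x` and at
those in `∂`. Both localizations are left principal ideal rings, and in characteristic `0` the two
Ore sets are comaximal. Adding the two local ranks bounds chains of left ideals. For heredity, a
left ideal is free over `k[x]`, which gives projective dimension at most one. The resulting
resolution splits locally, and comaximality glues the splittings. -/

namespace PPFormula

variable {R : Type u} [Ring R]

theorem map_mem_eval (φ : PPFormula R) {M : Type v} {N : Type w} [AddCommGroup M] [Module R M]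
    [AddCommGroup N] [Module R N] (f : M →ₗ[R] N) {x : M} (hx : x ∈ φ.eval M) :
    f x ∈ φ.eval N := by
  obtain ⟨y, hy⟩ := hx
  exact ⟨fun j => f (y j), fun i => by rw [← map_smul, ← hy, map_sum]; simp only [map_smul]⟩

/-- The divisibility formula `r ∣ x`. -/
def dvd (r : R) : PPFormula R where
  numVars := 1
  numEqs := 1
  A := fun _ _ => r
  b := fun _ => 1

theorem mem_eval_dvd (r : R) {M : Type w} [AddCommGroup M] [Module R M] {x : M} :
    x ∈ (dvd r).eval M ↔ ∃ y : M, r • y = x := by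
  change (∃ y : Fin 1 → M, ∀ _ : Fin 1, ∑ j, r • y j = (1 : R) • x) ↔ _
  constructor
  · rintro ⟨y, hy⟩
    exact ⟨y 0, by simpa using hy 0⟩
  · rintro ⟨y, hy⟩
    exact ⟨fun _ => y, fun _ => by simpa using hy⟩

end PPFormula

/-! ### Pushouts along cyclic modules, and purity in them. -/

section Pushout

variable {R : Type u} [Ring R]

/-- The pushout of `E` and `N` along the maps `R → E`, `1 ↦ e` and `R → N`, `1 ↦ a`. -/
abbrev CyclicPushout {E N : Type w} [AddCommGroup E] [Module R E] [AddCommGroup N] [Module R N]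
    (e : E) (a : N) : Type w :=
  (E × N) ⧸ Submodule.span R {((e, -a) : E × N)}

namespace CyclicPushout

variable {E N : Type w} [AddCommGroup E] [Module R E] [AddCommGroup N] [Module R N] (e : E) (a : N)

/-- The first map into the pushout. -/
def inl : E →ₗ[R] CyclicPushout (R := R) e a := Submodule.mkQ _ ∘ₗ LinearMap.inl R E N

/-- The second map into the pushout. -/
def inr : N →ₗ[R] CyclicPushout (R := R) e a := Submodule.mkQ _ ∘ₗ LinearMap.inr R E N

theorem mk_eq_mk_iff {p q : E × N} :
    (Submodule.Quotient.mk p : CyclicPushout (R := R) e a) = Submodule.Quotient.mk q ↔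
      ∃ r : R, r • e = p.1 - q.1 ∧ r • a = q.2 - p.2 := by
  rw [Submodule.Quotient.eq, Submodule.mem_span_singleton]
  refine exists_congr fun r => ?_
  rw [Prod.ext_iff]
  simp only [Prod.smul_fst, Prod.smul_snd, Prod.fst_sub, Prod.snd_sub, smul_neg, neg_eq_iff_eq_neg,
    neg_sub]

theorem inl_eq_inr : inl (R := R) e a e = inr e a a := by
  change (Submodule.Quotient.mk (e, 0) : CyclicPushout (R := R) e a) =
    Submodule.Quotient.mk (0, a)
  rw [mk_eq_mk_iff]
  exact ⟨1, by simp, by simp⟩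

variable {e}

theorem inr_injective (he : ∀ r : R, r • e = 0 → r = 0) :
    Function.Injective (inr (R := R) e a) := by
  intro n n' h
  obtain ⟨r, h1, h2⟩ := (mk_eq_mk_iff e a).1 h
  obtain rfl : r = 0 := he r (by simpa using h1)
  simpa [sub_eq_zero, eq_comm] using h2

/-- If `a` satisfies every pp formula that `e` satisfies, then `N` is pure in the pushout. -/
theorem isPureSubmodule_range_inr
    (ha : ∀ φ : PPFormula R, e ∈ φ.eval E → a ∈ φ.eval N) :
    IsPureSubmodule (LinearMap.range (inr (R := R) e a)) := by
  rintro φ ⟨_, n, rfl⟩ ⟨y, hy⟩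
  choose z hz using fun j => Submodule.Quotient.mk_surjective _ (y j)
  -- A solution in the pushout lifts to `E × N` only up to multiples `r i` of the glued pair `(e,
  -- -a)`.
  have key : ∀ i, ∃ r : R, r • e = ∑ j, φ.A i j • (z j).1 ∧
      r • a = φ.b i • n - ∑ j, φ.A i j • (z j).2 := by
    intro i
    have h := hy i
    simp only [← hz] at h
    have h' : (Submodule.Quotient.mk (∑ j, φ.A i j • z j) : CyclicPushout (R := R) e a) =
        Submodule.Quotient.mk (φ.b i • ((0, n) : E × N)) := by
      rw [← Submodule.mkQ_apply, map_sum]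
      simp only [map_smul]
      exact h
    simpa [Prod.fst_sum, Prod.snd_sum] using (mk_eq_mk_iff e a).1 h'
  choose r hr1 hr2 using key
  -- The `E`-components show that `e` satisfies `∃ y, A y = r x`. So does `a`, and a solution `m` in
  -- `N` can replace those components.
  obtain ⟨m, hm⟩ : a ∈ (PPFormula.mk φ.numVars φ.numEqs φ.A r).eval N :=
    ha _ ⟨fun j => (z j).1, fun i => (hr1 i).symm⟩
  have hn : n ∈ φ.eval N := by
    refine ⟨fun j => m j + (z j).2, fun i => ?_⟩
    have := hm i
    simp only at this
    simp only [smul_add, Finset.sum_add_distrib]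
    rw [this, hr2, sub_add_cancel]
  exact φ.map_mem_eval (inr (R := R) e a).rangeRestrict hn

end CyclicPushout

end Pushout

/-! ### Ulm submodules of pure injective modules over RD domains. -/

section Ulm

variable {R : Type u} [Ring R]

theorem PPFormula.mem_eval_of_injective {E M : Type w} [AddCommGroup E] [Module R E]
    [AddCommGroup M] [Module R M] (hE : IsAbsolutelyPure R E) {f : E →ₗ[R] M}
    (hf : Function.Injective f) (φ : PPFormula R) {x : E} (hx : f x ∈ φ.eval M) :
    x ∈ φ.eval E := by
  have := φ.map_mem_eval (LinearEquiv.ofInjective f hf).symm.toLinearMap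
    (hE M f hf φ (LinearEquiv.ofInjective f hf x) hx)
  simpa using this

/-- As `e` has zero annihilator, any `D` embeds in the pushout along `e ↦ d`, where `d` inherits `φ`
from `e`; absolute purity brings `φ` back to `D`. -/
theorem PPFormula.isHigh_of_mem {E : Type w} [AddCommGroup E] [Module R E] {e : E}
    (he : ∀ r : R, r • e = 0 → r = 0) {φ : PPFormula R} (h : e ∈ φ.eval E) :
    PPFormula.IsHigh.{u, w} φ := by
  intro D _ _ hD
  refine eq_top_iff.2 fun d _ => ?_
  refine φ.mem_eval_of_injective hD (CyclicPushout.inr_injective d he) ?_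
  rw [← CyclicPushout.inl_eq_inr]
  exact φ.map_mem_eval _ h

/-- The formulas true of `e` are high, hence true of `a`, so `N` is pure in the pushout. A
retraction of the pushout onto `N`, restricted to `E`, is the map sought. -/
theorem exists_linearMap_of_mem_ulm {N : Type w} [AddCommGroup N] [Module R N]
    (hN : IsPureInjective R N) {E : Type w} [AddCommGroup E] [Module R E] {e : E}
    (he : ∀ r : R, r • e = 0 → r = 0) {a : N} (ha : a ∈ ulm R N) : ∃ f : E →ₗ[R] N, f e = a := by
  have hinj := CyclicPushout.inr_injective (R := R) a he
  obtain ⟨g, hg⟩ := hN _ _ (CyclicPushout.isPureSubmodule_range_inr (R := R) (e := e) a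
    fun φ hφ => ha φ (φ.isHigh_of_mem he hφ)) (LinearEquiv.ofInjective _ hinj).symm.toLinearMap
  refine ⟨g ∘ₗ CyclicPushout.inl e a, ?_⟩
  rw [LinearMap.comp_apply, CyclicPushout.inl_eq_inr]
  have := hg (LinearEquiv.ofInjective _ hinj a)
  simpa using this

theorem map_mem_ulm {M N : Type w} [AddCommGroup M] [Module R M] [AddCommGroup N] [Module R N]
    (f : M →ₗ[R] N) {x : M} (hx : x ∈ ulm R M) : f x ∈ ulm R N :=
  fun φ hφ => φ.map_mem_eval f (hx φ hφ)

theorem IsAbsolutelyPure.ulm_eq_top {E : Type w} [AddCommGroup E] [Module R E]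
    (hE : IsAbsolutelyPure R E) : ulm R E = ⊤ :=
  eq_top_iff.2 fun x _ φ hφ => by rw [hφ E hE]; trivial

theorem Module.Injective.exists_leftInverse {E M : Type w} [AddCommGroup E] [Module R E]
    [AddCommGroup M] [Module R M] (hE : Module.Injective R E) {f : E →ₗ[R] M}
    (hf : Function.Injective f) : ∃ g : M →ₗ[R] E, ∀ x, g (f x) = x :=
  hE.out f hf LinearMap.id

theorem Module.Injective.isAbsolutelyPure {E : Type w} [AddCommGroup E] [Module R E]
    (hE : Module.Injective R E) : IsAbsolutelyPure R E := by
  rintro M _ _ f hf φ ⟨_, x, rfl⟩ h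
  obtain ⟨g, hg⟩ := hE.exists_leftInverse hf
  have h' := φ.map_mem_eval g h
  simp only [hg] at h'
  exact φ.map_mem_eval f.rangeRestrict h'

theorem exists_injective_embedding (M : Type (max u v)) [AddCommGroup M] [Module R M] :
    ∃ (E : Type (max u v)) (_ : AddCommGroup E) (_ : Module R E) (f : M →ₗ[R] E),
      Module.Injective R E ∧ Function.Injective f := by
  obtain ⟨⟨J, hJ, f, hf⟩⟩ := (ModuleCat.enoughInjectives.{v} R).presentation (ModuleCat.of R M)
  exact ⟨J, inferInstance, inferInstance, f.hom, Module.injective_module_of_injective_object R J,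
    (ModuleCat.mono_iff_injective f).1 hf⟩

/-- Right multiplication by `r` is an injective endomorphism of the left module `R`. Extending `1 ↦
e` along it divides `e` by `r`. -/
theorem Module.Injective.exists_smul_eq [IsDomain R] {E : Type (max u v)} [AddCommGroup E]
    [Module R E] (hE : Module.Injective R E) {r : R} (hr : r ≠ 0) (e : E) :
    ∃ e' : E, r • e' = e := by
  let m : ULift.{v} R →ₗ[R] ULift.{v} R := LinearMap.toSpanSingleton R _ (ULift.up r) ∘ₗ
    (ULift.moduleEquiv (R := R) (M := R)).toLinearMap
  have hm : Function.Injective m := by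
    rintro ⟨s⟩ ⟨t⟩ h
    simpa [m, hr] using congrArg ULift.down h
  obtain ⟨h, hh⟩ := hE.out m hm (LinearMap.toSpanSingleton R E e ∘ₗ ULift.moduleEquiv.toLinearMap)
  refine ⟨h (ULift.up 1), ?_⟩
  have := hh (ULift.up 1)
  have hm1 : m (ULift.up 1) = r • ULift.up 1 := by
    ext
    simp [m]
  rw [← map_smul, ← hm1, this]
  simp

theorem isAbsolutelyPure_of_divisible (hR : IsRDRing.{u, w} R) {E : Type w} [AddCommGroup E]
    [Module R E] (hE : ∀ r : R, r ≠ 0 → ∀ e : E, ∃ e' : E, r • e' = e) :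
    IsAbsolutelyPure R E := by
  refine fun M _ _ f _ => (hR M _).2 ?_
  rintro r ⟨_, x, rfl⟩ ⟨m, hm⟩
  by_cases hr : r = 0
  · subst hr
    exact ⟨0, Subtype.ext (by simpa using hm)⟩
  · obtain ⟨x', rfl⟩ := hE r hr x
    exact ⟨f.rangeRestrict x', by ext; simp⟩

/-- Each element of `u(N)` is the image of `1` under a map to `N` from an injective module
containing `R`. That module is divisible and is its own Ulm submodule, so quotients by `r` can be
taken inside `u(N)`. -/
theorem ulm_isAbsolutelyPure [IsDomain R] (hR : IsRDRing.{u, max u v} R) {N : Type (max u v)}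
    [AddCommGroup N] [Module R N] (hN : IsPureInjective R N) :
    IsAbsolutelyPure R (ulm R N) := by
  refine isAbsolutelyPure_of_divisible hR fun r hr ⟨a, ha⟩ => ?_
  obtain ⟨E, _, _, f, hE, hf⟩ := exists_injective_embedding.{u, v} (R := R) (ULift.{v} R)
  have he : ∀ r : R, r • f (ULift.up 1) = 0 → r = 0 := by
    intro r h
    rw [← map_smul, map_eq_zero_iff f hf] at h
    simpa using congrArg ULift.down h
  obtain ⟨g, rfl⟩ := exists_linearMap_of_mem_ulm hN he ha
  obtain ⟨e', he'⟩ := hE.exists_smul_eq hr (f (ULift.up 1))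
  refine ⟨⟨g e', map_mem_ulm g ?_⟩, Subtype.ext ?_⟩
  · rw [hE.isAbsolutelyPure.ulm_eq_top]; trivial
  · simp [← he']

/-- The inclusion `u(N) → N` extends to an injective module in which `u(N)` is pure. The extension
lands in `u(N)`, so `u(N)` is a retract of an injective module. -/
theorem ulm_injective [IsDomain R] (hR : IsRDRing.{u, max u v} R) {N : Type (max u v)}
    [AddCommGroup N] [Module R N] (hN : IsPureInjective R N) :
    Module.Injective R (ulm R N) := by
  obtain ⟨E, _, _, f, hE, hf⟩ := exists_injective_embedding.{u, v} (R := R) (ulm R N)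
  obtain ⟨g, hg⟩ := hN E _ (ulm_isAbsolutelyPure hR hN E f hf)
    ((ulm R N).subtype ∘ₗ (LinearEquiv.ofInjective f hf).symm.toLinearMap)
  have hgu : ∀ x, g x ∈ ulm R N := fun x =>
    map_mem_ulm g (by rw [hE.isAbsolutelyPure.ulm_eq_top]; trivial)
  refine ⟨fun X Y _ _ _ _ i hi h => ?_⟩
  obtain ⟨k, hk⟩ := hE.out i hi (f ∘ₗ h)
  refine ⟨g.codRestrict _ hgu ∘ₗ k, fun x => Subtype.ext ?_⟩
  have := hg (LinearEquiv.ofInjective f hf (h x))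
  simp only [LinearMap.comp_apply, LinearEquiv.coe_coe, LinearEquiv.symm_apply_apply] at this
  simpa [hk] using this

theorem ulm_eq_lastUlm {N : Type w} [AddCommGroup N] [Module R N]
    (hN : IsAbsolutelyPure R (ulm R N)) : ulm R N = lastUlm R N := by
  have h1 : ulmSeq R N 1 = ulm R N := by
    have := ulmSeq_add_one R N 0
    rw [zero_add] at this
    rw [this, ulmSeq_zero]
    refine le_antisymm ?_ ?_
    · rintro _ ⟨x, hx, rfl⟩
      exact map_mem_ulm _ hx
    · intro x hx
      exact ⟨⟨x, trivial⟩, map_mem_ulm (Submodule.topEquiv (R := R) (M := N)).symm.toLinearMap hx,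
        rfl⟩
  have h2 : ulmSeq R N (1 + 1) = ulmSeq R N 1 := by
    rw [ulmSeq_add_one, h1, hN.ulm_eq_top, Submodule.map_top, Submodule.range_subtype]
  -- The length is `0` rather than `1` when `u(N) = N`, so both cases remain.
  have hle : ulmLength R N ≤ 1 := csInf_le' h2
  rw [lastUlm]
  rcases hle.lt_or_eq with h | h
  · have h0 : ulmLength R N = 0 := Order.lt_one_iff.1 h
    have := ulmSeq_ulmLength_add_one R N
    rw [h0, zero_add] at this
    rw [h0, ← this, h1]
  · rw [h, h1]

theorem ulm_of_isPureInjective [IsDomain R] (hR : IsRDRing.{u, max u v} R) (N : Type (max u v))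
    [AddCommGroup N] [Module R N] (hN : IsPureInjective R N) :
    Module.Injective R (ulm R N) ∧
      (∃ Nr : Submodule R N, IsCompl (ulm R N) Nr ∧ ulm R Nr = ⊥) ∧
      ulm R N = lastUlm R N ∧
      IsGreatest {U : Submodule R N | Module.Injective R U} (ulm R N) := by
  have hinj := ulm_injective hR hN
  have hpure := ulm_isAbsolutelyPure hR hN
  refine ⟨hinj, ?_, ulm_eq_lastUlm hpure, hinj, fun U hU x hx => ?_⟩
  · obtain ⟨g, hg⟩ := hinj.exists_leftInverse (ulm R N).injective_subtype
    have hc : IsCompl (ulm R N) (LinearMap.ker g) := LinearMap.isCompl_of_proj hg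
    refine ⟨LinearMap.ker g, hc, (Submodule.eq_bot_iff _).2 fun x hx => Subtype.ext ?_⟩
    exact Submodule.disjoint_def.1 hc.disjoint x (map_mem_ulm (LinearMap.ker g).subtype hx) x.2
  · have : (⟨x, hx⟩ : U) ∈ ulm R U := by
      rw [(Module.Injective.isAbsolutelyPure hU).ulm_eq_top]; trivial
    exact map_mem_ulm U.subtype this

end Ulm

/-! ### Ore conditions, and torsion modules over simple rings. -/

section Torsion

variable {R : Type u} [Ring R]

/-- Without a common multiple, `(s, t) ↦ s a - t b` would embed `R²` in `R`, which a nonzero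
noetherian ring forbids. -/
theorem exists_left_common_multiple [IsDomain R] [IsNoetherianRing R] (a : R) {b : R}
    (hb : b ≠ 0) : ∃ u v : R, u ≠ 0 ∧ u * a = v * b := by
  by_cases ha : a = 0
  · exact ⟨1, 0, one_ne_zero, by simp [ha]⟩
  by_contra! hcon
  let f : (Fin 2 → R) →ₗ[R] (Fin 1 → R) := LinearMap.pi fun _ =>
    LinearMap.toSpanSingleton R R a ∘ₗ LinearMap.proj 0 -
      LinearMap.toSpanSingleton R R b ∘ₗ LinearMap.proj 1
  have hf : Function.Injective f := by
    refine (injective_iff_map_eq_zero f).2 fun x hx => ?_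
    have h : x 0 * a = x 1 * b := by simpa [f, sub_eq_zero] using congrFun hx 0
    have h0 : x 0 = 0 := by
      by_contra h0
      exact hcon _ _ h0 h
    have h1 : x 1 = 0 := by simpa [h0, hb] using h.symm
    ext i
    fin_cases i <;> simpa
  simpa using le_of_fin_injective R f hf

theorem exists_right_common_multiple [IsDomain R] [IsNoetherianRing Rᵐᵒᵖ] (a : R) {b : R}
    (hb : b ≠ 0) : ∃ u v : R, u ≠ 0 ∧ a * u = b * v := by
  obtain ⟨u, v, hu, h⟩ := exists_left_common_multiple (MulOpposite.op a)
    (b := MulOpposite.op b) (by simpa using hb)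
  exact ⟨u.unop, v.unop, by simpa using hu, by simpa using congrArg MulOpposite.unop h⟩

/-- The element `x` is killed by a nonzero ring element. -/
def IsTorsionElement (R : Type u) [Ring R] {M : Type v} [AddCommGroup M] [Module R M] (x : M) :
    Prop :=
  ∃ r : R, r ≠ 0 ∧ r • x = 0

variable {M : Type v} [AddCommGroup M] [Module R M]

/-- All quotients of `R` by nonzero principal left ideals are artinian. -/
def HasArtinianQuotients (R : Type u) [Ring R] : Prop :=
  ∀ r : R, r ≠ 0 → IsArtinian R (R ⧸ Ideal.span {r})

theorem HasArtinianQuotients.isArtinian_span_singleton (hR : HasArtinianQuotients R) {x : M}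
    (hx : IsTorsionElement R x) : IsArtinian R (Submodule.span R {x}) := by
  obtain ⟨r, hr, hrx⟩ := hx
  have := hR r hr
  have hle : Ideal.span {r} ≤ LinearMap.ker (LinearMap.toSpanSingleton R M x) := by
    rw [Ideal.span_le, Set.singleton_subset_iff]
    simpa using hrx
  rw [← LinearMap.range_toSpanSingleton,
    ← Submodule.range_liftQ (Ideal.span {r}) (LinearMap.toSpanSingleton R M x) hle]
  infer_instance

theorem HasArtinianQuotients.isArtinian (hR : HasArtinianQuotients R) [Module.Finite R M]
    (hM : ∀ x : M, IsTorsionElement R x) : IsArtinian R M := by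
  obtain ⟨s, hs⟩ := Module.Finite.fg_top (R := R) (M := M)
  have : IsArtinian R (⨆ x : s, Submodule.span R {(x : M)} : Submodule R M) := by
    have := fun x : s => hR.isArtinian_span_singleton (hM x)
    infer_instance
  have htop : ⨆ x : s, Submodule.span R {(x : M)} = ⊤ := by
    rw [← hs, Submodule.span_eq_iSup_of_singleton_spans, iSup_subtype]
    rfl
  rw [htop] at this
  exact isArtinian_of_linearEquiv Submodule.topEquiv

/-- The elements `a` with `a R x ⊆ W` form a two-sided ideal. It contains `n`, hence also `1`. -/
theorem smul_smul_eq_zero_imp [IsSimpleRing R] {n : R} (hn : n ≠ 0) {W : Submodule R M} {x : M}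
    (h : ∀ r : R, n • r • x ∈ W) : x ∈ W := by
  let J : TwoSidedIdeal R := TwoSidedIdeal.mk' {a | ∀ r : R, a • r • x ∈ W}
    (fun r => by simp) (fun ha hb r => by rw [add_smul]; exact W.add_mem (ha r) (hb r))
    (fun ha r => by rw [neg_smul]; exact W.neg_mem (ha r))
    (fun ha r => by rw [mul_smul]; exact W.smul_mem _ (ha r))
    (fun {a b} ha r => by rw [mul_smul, smul_smul b]; exact ha _)
  have hnJ : n ∈ J := by simpa [J, TwoSidedIdeal.mem_mk'] using h
  have := IsSimpleRing.one_mem_of_ne_zero_mem J hn hnJ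
  have h1 : ∀ r : R, (1 : R) • r • x ∈ W := by simpa [J, TwoSidedIdeal.mem_mk'] using this
  simpa using h1 1

/-- Over a simple ring, torsion modules of finite length are cyclic. -/
theorem exists_span_singleton_eq_top [IsSimpleRing R] [IsNoetherian R M] [IsArtinian R M]
    (hM : ∀ x : M, IsTorsionElement R x) : ∃ z : M, Submodule.span R {z} = ⊤ := by
  -- With `W` minimal such that `R z + W = M`, the aim is `W = 0`. Otherwise `z` is perturbed by an
  -- element of `W` so that a maximal proper submodule `W'` of `W` suffices.
  obtain ⟨W, ⟨z, hz⟩, hW⟩ := IsArtinian.set_has_minimal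
    {W : Submodule R M | ∃ z, Submodule.span R {z} ⊔ W = ⊤} ⟨⊤, 0, by simp⟩
  by_cases hbot : W = ⊥
  · exact ⟨z, by simpa [hbot] using hz⟩
  exfalso
  obtain ⟨W', hW'⟩ : ∃ W', W' ⋖ W := by
    obtain ⟨W', hlt, hmax⟩ := set_has_maximal_iff_noetherian.2 ‹IsNoetherian R M›
      {V | V < W} ⟨⊥, bot_lt_iff_ne_bot.2 hbot⟩
    exact ⟨W', hlt, fun V h1 h2 => hmax V h2 h1⟩
  obtain ⟨n, hn, hnz⟩ := hM z
  -- As `n` kills `z`, it sends `z + w` to `n w`, which together with `W'` generates `W`.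
  obtain ⟨w, hwW, hw⟩ : ∃ w ∈ W, n • w ∉ W' := by
    by_contra! hcon
    exact hW'.lt.not_ge fun w hw => smul_smul_eq_zero_imp hn fun r => hcon _ (W.smul_mem r hw)
  refine hW W' ⟨z + w, ?_⟩ hW'.lt
  have hle : W ≤ Submodule.span R {z + w} ⊔ W' := by
    have h1 : W' ⊔ Submodule.span R {n • w} = W := by
      refine (hW'.eq_or_eq le_sup_left (sup_le hW'.le ?_)).resolve_left fun h => ?_
      · rw [Submodule.span_singleton_le_iff_mem]
        exact W.smul_mem _ hwW
      · exact hw (h.le (Submodule.mem_sup_right (Submodule.mem_span_singleton_self _)))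
    rw [← h1]
    refine sup_le le_sup_right ?_
    rw [Submodule.span_singleton_le_iff_mem]
    refine Submodule.mem_sup_left (Submodule.mem_span_singleton.2 ⟨n, ?_⟩)
    rw [smul_add, hnz, zero_add]
  rw [eq_top_iff, ← hz]
  refine sup_le ?_ hle
  rw [Submodule.span_singleton_le_iff_mem]
  have h2 : z + w ∈ Submodule.span R {z + w} ⊔ W' :=
    Submodule.mem_sup_left (Submodule.mem_span_singleton_self _)
  simpa using Submodule.sub_mem _ h2 (hle hwW)

end Torsion

/-! ### Lifting through relatively divisible submodules, and a criterion for RD rings. -/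

section Lifting

variable {R : Type u} [Ring R]

/-- A linear map that vanishes on the kernel of a surjection factors through it. -/
theorem LinearMap.exists_comp_eq_of_ker_le {A B C : Type*} [AddCommGroup A] [Module R A]
    [AddCommGroup B] [Module R B] [AddCommGroup C] [Module R C] {p : A →ₗ[R] B}
    (hp : Function.Surjective p) {h : A →ₗ[R] C} (hle : LinearMap.ker p ≤ LinearMap.ker h) :
    ∃ g : B →ₗ[R] C, ∀ a, g (p a) = h a := by
  refine ⟨(LinearMap.ker p).liftQ h hle ∘ₗ (p.quotKerEquivOfSurjective hp).symm.toLinearMap,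
    fun a => ?_⟩
  have : (p.quotKerEquivOfSurjective hp).symm (p a) = Submodule.Quotient.mk a := by
    rw [LinearEquiv.symm_apply_eq]
    rfl
  simp [this]

theorem Module.Projective.exists_dual_basis {P : Type v} [AddCommGroup P] [Module R P]
    [Module.Finite R P] [Module.Projective R P] :
    ∃ (n : ℕ) (q : Fin n → P →ₗ[R] R) (c : Fin n → P), ∀ x, ∑ j, q j x • c j = x := by
  obtain ⟨n, f, hf⟩ := Module.Finite.exists_fin' R P
  obtain ⟨s, hs⟩ := Module.projective_lifting_property f LinearMap.id hf
  refine ⟨n, fun j => LinearMap.proj j ∘ₗ s, fun j => f (Pi.single j 1), fun x => ?_⟩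
  have h : f (s x) = x := LinearMap.congr_fun hs x
  conv_rhs => rw [← h, pi_eq_sum_univ' (s x), map_sum]
  refine Finset.sum_congr rfl fun j _ => ?_
  rw [map_smul]
  congr 2

/-- Let `I` be a nonzero projective left ideal. If the right module `Hom(I, R)/R` is cyclic, then
`R/I` is a direct summand of a cyclically presented module. -/
theorem exists_sub_mul_mem_span [IsDomain R] [IsSimpleRing R] [IsNoetherianRing R]
    [IsNoetherianRing Rᵐᵒᵖ] (hR : HasArtinianQuotients Rᵐᵒᵖ) {I : Ideal R} (hI : I ≠ ⊥)
    [Module.Projective R I] :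
    ∃ a ∈ I, ∃ b ∈ I, ∀ i ∈ I, i - i * a ∈ Ideal.span {b} := by
  obtain ⟨n, q, c, hqc⟩ := Module.Projective.exists_dual_basis (R := R) (P := I)
  let L : Submodule Rᵐᵒᵖ (I →ₗ[R] R) := Submodule.span Rᵐᵒᵖ {I.subtype}
  -- By the left Ore condition a linear form on `I` is determined by its value at one `i₀ ≠ 0`. If
  -- `q(i₀) r = i₀ s`, then `q` times `r` is right multiplication by `s`, which lies in `L`.
  have htors : ∀ x : (I →ₗ[R] R) ⧸ L, IsTorsionElement Rᵐᵒᵖ x := by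
    intro x
    obtain ⟨q, rfl⟩ := Submodule.Quotient.mk_surjective _ x
    obtain ⟨i₀, hi₀, hne⟩ := (Submodule.ne_bot_iff I).1 hI
    obtain ⟨r, s, hr, h⟩ := exists_right_common_multiple (q ⟨i₀, hi₀⟩) hne
    refine ⟨MulOpposite.op r, by simpa using hr, ?_⟩
    rw [← Submodule.Quotient.mk_smul, Submodule.Quotient.mk_eq_zero]
    refine Submodule.mem_span_singleton.2 ⟨MulOpposite.op s, ?_⟩
    ext ⟨i, hi⟩
    obtain ⟨u, v, hu, huv⟩ := exists_left_common_multiple i hne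
    have h1 : u * q ⟨i, hi⟩ = v * q ⟨i₀, hi₀⟩ := by
      rw [← smul_eq_mul, ← smul_eq_mul, ← map_smul, ← map_smul]
      exact congrArg q (Subtype.ext huv)
    refine mul_left_cancel₀ hu ?_
    simp only [LinearMap.smul_apply, MulOpposite.smul_eq_mul_unop, MulOpposite.unop_op,
      Submodule.subtype_apply]
    rw [← mul_assoc, ← mul_assoc, huv, h1, mul_assoc, mul_assoc, h]
  let Y : Submodule Rᵐᵒᵖ ((I →ₗ[R] R) ⧸ L) :=
    Submodule.span Rᵐᵒᵖ (Set.range fun j => Submodule.Quotient.mk (q j))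
  have hY : ∀ y : Y, IsTorsionElement Rᵐᵒᵖ y := fun y => by
    obtain ⟨r, hr, h⟩ := htors y
    exact ⟨r, hr, Subtype.ext h⟩
  have : Module.Finite Rᵐᵒᵖ Y := Module.Finite.span_of_finite _ (Set.finite_range _)
  have := hR.isArtinian hY
  have : IsNoetherian Rᵐᵒᵖ Y := isNoetherian_of_isNoetherianRing_of_finite _ _
  obtain ⟨⟨z, hzY⟩, hz⟩ := exists_span_singleton_eq_top hY
  obtain ⟨q', rfl⟩ := Submodule.Quotient.mk_surjective _ z
  -- The single form `q'` generates the dual basis modulo `L`. The dual basis identity then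
  -- collapses to `i = i a + q'(i) b`.
  have key : ∀ j, ∃ s t : R, ∀ i : I, q j i = i * s + q' i * t := by
    intro j
    have h1 : (⟨Submodule.Quotient.mk (q j), Submodule.subset_span ⟨j, rfl⟩⟩ : Y) ∈
        Submodule.span Rᵐᵒᵖ {(⟨Submodule.Quotient.mk q', hzY⟩ : Y)} := by
      rw [hz]; trivial
    obtain ⟨t, ht⟩ := Submodule.mem_span_singleton.1 h1
    have h2 : (Submodule.Quotient.mk (q j) : (I →ₗ[R] R) ⧸ L) =
      Submodule.Quotient.mk (t • q') := (congrArg Subtype.val ht).symm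
    rw [Submodule.Quotient.eq] at h2
    obtain ⟨s, hs⟩ := Submodule.mem_span_singleton.1 h2
    refine ⟨s.unop, t.unop, fun i => ?_⟩
    have h3 := LinearMap.congr_fun hs i
    simp only [LinearMap.smul_apply, MulOpposite.smul_eq_mul_unop, LinearMap.sub_apply,
      Submodule.subtype_apply] at h3
    rw [h3, sub_add_cancel]
  choose s t hst using key
  refine ⟨∑ j, s j * c j, I.sum_mem fun j _ => I.mul_mem_left _ (c j).2,
    ∑ j, t j * c j, I.sum_mem fun j _ => I.mul_mem_left _ (c j).2, fun i hi => ?_⟩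
  refine Ideal.mem_span_singleton'.2 ⟨q' ⟨i, hi⟩, ?_⟩
  have h1 : ∑ j, q j ⟨i, hi⟩ * (c j : R) = i := by
    simpa using congrArg Subtype.val (hqc ⟨i, hi⟩)
  rw [eq_sub_iff_add_eq]
  conv_rhs => rw [← h1]
  rw [Finset.mul_sum, Finset.mul_sum, ← Finset.sum_add_distrib]
  refine Finset.sum_congr rfl fun j _ => ?_
  rw [hst, add_mul, mul_assoc, mul_assoc, add_comm]

variable {F : Type v} [AddCommGroup F] [Module R F]

/-- A form nonzero at `y` exists on `R y`. It can be pushed one generator further once it is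
multiplied on the right by a nonzero denominator, and the noetherian condition ends the process at
`F`. -/
theorem exists_hom_ne_zero [IsDomain R] [IsNoetherianRing R] [IsNoetherianRing Rᵐᵒᵖ]
    [Module.Finite R F] {y : F} (hy : ¬ IsTorsionElement R y) :
    ∃ g : F →ₗ[R] R, g y ≠ 0 := by
  have hy' : ∀ r : R, r • y = 0 → r = 0 := fun r h => by
    by_contra hr
    exact hy ⟨r, hr, h⟩
  have hnoeth : IsNoetherian R F := isNoetherian_of_isNoetherianRing_of_finite R F
  obtain ⟨N, ⟨hyN, f, hf⟩, hmax⟩ := set_has_maximal_iff_noetherian.2 hnoeth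
    {N | ∃ (hyN : y ∈ N) (f : N →ₗ[R] R), f ⟨y, hyN⟩ ≠ 0} (by
      let e := LinearMap.toSpanSingleton R F y
      have he : Function.Injective e := (injective_iff_map_eq_zero e).2 hy'
      refine ⟨LinearMap.range e, ⟨1, by simp [e]⟩, (LinearEquiv.ofInjective e he).symm.toLinearMap,
        fun h => ?_⟩
      have h1 := (LinearEquiv.map_eq_zero_iff _).1 h
      have h2 : y = 0 := congrArg Subtype.val h1
      exact one_ne_zero (hy' 1 (by rw [h2, smul_zero])))
  by_cases htop : N = ⊤
  · subst htop
    exact ⟨f ∘ₗ Submodule.topEquiv.symm.toLinearMap, hf⟩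
  exfalso
  obtain ⟨x, -, hx⟩ := SetLike.exists_of_lt (lt_top_iff_ne_top.2 htop)
  have hx1 : x ∈ N ⊔ Submodule.span R {x} :=
    Submodule.mem_sup_right (Submodule.mem_span_singleton_self _)
  -- The form `f` times `d` is to be extended by `x ↦ w`. If `r x ∈ N`, the choice `f(r x) d = r w`
  -- is forced; otherwise `x` is free over `N` and `w = 0` works.
  obtain ⟨d, w, hd, hdw⟩ : ∃ d w : R, d ≠ 0 ∧ ∀ (n : N) (r : R), (n : F) + r • x = 0 →
      f n * d + r * w = 0 := by
    by_cases hr : ∃ r : R, r ≠ 0 ∧ r • x ∈ N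
    · obtain ⟨r, hr, hrx⟩ := hr
      obtain ⟨d, w, hd, h⟩ := exists_right_common_multiple (f ⟨r • x, hrx⟩) hr
      refine ⟨d, w, hd, fun n s hns => ?_⟩
      obtain ⟨u, v, hu, huv⟩ := exists_left_common_multiple s hr
      have h1 : u • n = (-v) • (⟨r • x, hrx⟩ : N) := by
        refine Subtype.ext ?_
        rw [Submodule.coe_smul, Submodule.coe_smul, eq_neg_of_add_eq_zero_left hns, smul_neg,
          smul_smul, huv, neg_smul, smul_smul]
      have h2 : u * f n = -v * f ⟨r • x, hrx⟩ := by
        rw [← smul_eq_mul, ← smul_eq_mul, ← map_smul, ← map_smul, h1]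
      refine mul_left_cancel₀ hu ?_
      rw [mul_add, ← mul_assoc, ← mul_assoc, h2, huv, mul_assoc, h, mul_zero]
      noncomm_ring
    · push Not at hr
      refine ⟨1, 0, one_ne_zero, fun n r h => ?_⟩
      have h0 : r = 0 := by
        by_contra h0
        refine hr r h0 ?_
        rw [eq_neg_of_add_eq_zero_right h]
        exact N.neg_mem n.2
      subst h0
      obtain rfl : n = 0 := Subtype.ext (by simpa using h)
      simp
  let p : N × R →ₗ[R] (N ⊔ Submodule.span R {x} : Submodule R F) :=
    (Submodule.inclusion le_sup_left).coprod (LinearMap.toSpanSingleton R _ ⟨x, hx1⟩)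
  have hp : Function.Surjective p := by
    rintro ⟨m, hm⟩
    obtain ⟨n, hn, s, hs, rfl⟩ := Submodule.mem_sup.1 hm
    obtain ⟨r, rfl⟩ := Submodule.mem_span_singleton.1 hs
    exact ⟨(⟨n, hn⟩, r), Subtype.ext (by simp [p])⟩
  obtain ⟨g, hg⟩ := LinearMap.exists_comp_eq_of_ker_le hp
    (h := (LinearMap.toSpanSingleton R R d ∘ₗ f).coprod (LinearMap.toSpanSingleton R R w)) (by
      rintro ⟨n, r⟩ h
      have h' := congrArg Subtype.val (LinearMap.mem_ker.1 h)
      simpa using hdw n r (by simpa [p] using h'))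
  refine hmax (N ⊔ Submodule.span R {x}) ⟨Submodule.mem_sup_left hyN, g, ?_⟩
    (left_lt_sup.2 fun h => hx (h (Submodule.mem_span_singleton_self x)))
  have h1 : p (⟨y, hyN⟩, 0) = ⟨y, Submodule.mem_sup_left hyN⟩ := Subtype.ext (by simp [p])
  rw [← h1, hg]
  simpa using ⟨hf, hd⟩

/-- Over a noetherian hereditary domain, a finitely generated module is the direct sum of a
projective module and a torsion module. -/
theorem exists_isCompl_projective_torsion [IsDomain R] [IsNoetherianRing R]
    [IsNoetherianRing Rᵐᵒᵖ] (hproj : ∀ I : Ideal R, Module.Projective R I) [Module.Finite R F] :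
    ∃ P K : Submodule R F, IsCompl P K ∧ Module.Projective R P ∧
      ∀ x : K, IsTorsionElement R x := by
  have hnoeth : IsNoetherian R F := isNoetherian_of_isNoetherianRing_of_finite R F
  obtain ⟨P, ⟨hP, K, hPK⟩, hmax⟩ := set_has_maximal_iff_noetherian.2 hnoeth
    {P | Module.Projective R P ∧ ∃ K, IsCompl P K}
    ⟨⊥, inferInstance, ⊤, isCompl_bot_top⟩
  refine ⟨P, K, hPK, hP, ?_⟩
  by_contra! hcon
  obtain ⟨y, hy⟩ := hcon
  have : Module.Finite R K := Module.Finite.of_fg (hnoeth.noetherian K)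
  obtain ⟨g, hg⟩ := exists_hom_ne_zero hy
  have := hproj (LinearMap.range g)
  obtain ⟨s, hs⟩ := Module.projective_lifting_property g.rangeRestrict LinearMap.id
    g.surjective_rangeRestrict
  have hs' : ∀ x, g.rangeRestrict (s x) = x := LinearMap.congr_fun hs
  let π : F →ₗ[R] K := K.projectionOnto P hPK.symm
  let i : P × LinearMap.range g →ₗ[R] F := P.subtype.coprod (K.subtype ∘ₗ s)
  let j : F →ₗ[R] P × LinearMap.range g :=
    (P.projectionOnto K hPK).prod (g.rangeRestrict ∘ₗ π)
  have hji : ∀ x, j (i x) = x := by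
    rintro ⟨a, b⟩
    ext1
    · simp [i, j]
    · have : π (a + (s b : F)) = s b := by simp [π]
      change g.rangeRestrict (π (a + (s b : F))) = b
      rw [this, hs']
  have hi : Function.Injective i := Function.LeftInverse.injective hji
  let e := LinearEquiv.ofInjective i hi
  -- The nonzero left ideal `g(K)` is projective, so it splits off `K` and enlarges the maximal
  -- projective summand `P`.
  refine hmax (LinearMap.range i) ⟨Module.Projective.of_equiv e, LinearMap.ker j, ?_⟩ ?_
  · have := LinearMap.isCompl_of_proj (p := LinearMap.range i) (f := i.rangeRestrict ∘ₗ j) (by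
      rintro ⟨_, x, rfl⟩
      exact Subtype.ext (by simp [hji]))
    rwa [LinearMap.ker_comp_of_ker_eq_bot _ (by
      rw [LinearMap.ker_rangeRestrict, LinearMap.ker_eq_bot]; exact hi)] at this
  · refine lt_of_le_of_ne (fun x hx => ⟨(⟨x, hx⟩, 0), by simp [i]⟩) fun h => ?_
    have h1 : (s (g.rangeRestrict y) : F) ∈ P := by
      rw [h]
      exact ⟨(0, g.rangeRestrict y), by simp [i]⟩
    have h2 : s (g.rangeRestrict y) = 0 :=
      Subtype.ext (Submodule.disjoint_def.1 hPK.disjoint _ h1 (s (g.rangeRestrict y)).2)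
    have h3 := hs' (g.rangeRestrict y)
    rw [h2, map_zero] at h3
    exact hg (congrArg Subtype.val h3).symm

/-- A linear map from a finitely generated module to the quotient by a relatively divisible
submodule lifts. -/
theorem IsRDSubmodule.exists_lift [IsDomain R] [IsSimpleRing R] [IsNoetherianRing R]
    [IsNoetherianRing Rᵐᵒᵖ] (hR : HasArtinianQuotients R) (hR' : HasArtinianQuotients Rᵐᵒᵖ)
    (hproj : ∀ I : Ideal R, Module.Projective R I) [Module.Finite R F] {M : Type w}
    [AddCommGroup M] [Module R M] {A : Submodule R M} (hA : IsRDSubmodule A)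
    (f : F →ₗ[R] M ⧸ A) : ∃ s : F →ₗ[R] M, ∀ x, Submodule.Quotient.mk (s x) = f x := by
  obtain ⟨P, K, hPK, _, hK⟩ := exists_isCompl_projective_torsion (F := F) hproj
  obtain ⟨s₁, hs₁⟩ := Module.projective_lifting_property A.mkQ (f ∘ₗ P.subtype) A.mkQ_surjective
  have : IsNoetherian R F := isNoetherian_of_isNoetherianRing_of_finite R F
  have : Module.Finite R K := Module.Finite.of_fg (IsNoetherian.noetherian K)
  have := hR.isArtinian hK
  obtain ⟨z, hz⟩ := exists_span_singleton_eq_top hK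
  have hzsurj : Function.Surjective (LinearMap.toSpanSingleton R K z) := by
    rw [← LinearMap.range_eq_top, LinearMap.range_toSpanSingleton, hz]
  let I : Ideal R := LinearMap.ker (LinearMap.toSpanSingleton R K z)
  have hI : I ≠ ⊥ := by
    obtain ⟨r, hr, h⟩ := hK z
    exact (Submodule.ne_bot_iff _).2 ⟨r, h, hr⟩
  have := hproj I
  obtain ⟨a, ha, b, hb, hab⟩ := exists_sub_mul_mem_span hR' hI
  have hI0 : ∀ i ∈ I, i • f z = 0 := by
    intro i hi
    have h1 : i • z = 0 := hi
    rw [← map_smul, ← Submodule.coe_smul, h1, Submodule.coe_zero, map_zero]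
  obtain ⟨m₀, hm₀⟩ := Submodule.Quotient.mk_surjective _ (f z)
  have hmA : ∀ i ∈ I, ∀ m : M, Submodule.Quotient.mk m = f z → i • m ∈ A := by
    intro i hi m hm
    rw [← Submodule.Quotient.mk_eq_zero, Submodule.Quotient.mk_smul, hm, hI0 i hi]
  -- Relative divisibility enters here: `b m₀ ∈ A ∩ bM = bA`, so the lift of `f z` can be corrected
  -- to an `m` killed by `b`.
  obtain ⟨a', ha'⟩ := hA b ⟨b • m₀, hmA b hb m₀ hm₀⟩ ⟨m₀, rfl⟩
  let m : M := m₀ - a'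
  have hm : Submodule.Quotient.mk m = f z := by
    rw [← hm₀, Submodule.Quotient.eq]
    simp [m]
  have hbm : b • m = 0 := by
    have := congrArg Subtype.val ha'
    simp only [Submodule.coe_smul] at this
    simp [m, smul_sub, this]
  -- The map `z ↦ (1 - a) m` is well defined because `i (1 - a) ∈ R b` for `i ∈ I`. It still lifts
  -- `f` because `a` kills `f z`.
  obtain ⟨s₂, hs₂⟩ := LinearMap.exists_comp_eq_of_ker_le hzsurj
    (h := LinearMap.toSpanSingleton R M ((1 - a) • m)) (by
      intro i hi
      obtain ⟨c, hc⟩ := Ideal.mem_span_singleton'.1 (hab i hi)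
      rw [LinearMap.mem_ker, LinearMap.toSpanSingleton_apply, smul_smul, mul_sub, mul_one, ← hc,
        mul_smul, hbm, smul_zero])
  have hs₂' : ∀ x : K, Submodule.Quotient.mk (s₂ x) = f x := by
    intro x
    obtain ⟨r, rfl⟩ := hzsurj x
    rw [hs₂]
    simp only [LinearMap.toSpanSingleton_apply, Submodule.coe_smul, map_smul,
      Submodule.Quotient.mk_smul, sub_smul, one_smul, Submodule.Quotient.mk_sub, hm, hI0 a ha,
      sub_zero]
  refine ⟨s₁ ∘ₗ P.projectionOnto K hPK + s₂ ∘ₗ K.projectionOnto P hPK.symm, fun x => ?_⟩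
  have hs₁' : ∀ x : P, Submodule.Quotient.mk (s₁ x) = f x := LinearMap.congr_fun hs₁
  rw [LinearMap.add_apply, Submodule.Quotient.mk_add, LinearMap.comp_apply, LinearMap.comp_apply,
    hs₁', hs₂', ← map_add]
  congr 1
  exact Submodule.projection_add_projection_eq_self hPK x

theorem IsPureSubmodule.isRDSubmodule {M : Type w} [AddCommGroup M] [Module R M]
    {A : Submodule R M} (hA : IsPureSubmodule A) : IsRDSubmodule A := fun r a h =>
  (PPFormula.mem_eval_dvd r).1 (hA (PPFormula.dvd r) a ((PPFormula.mem_eval_dvd r).2 h))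

theorem isRDRing_of_isSimpleRing [IsDomain R] [IsSimpleRing R] [IsNoetherianRing R]
    [IsNoetherianRing Rᵐᵒᵖ] (hR : HasArtinianQuotients R) (hR' : HasArtinianQuotients Rᵐᵒᵖ)
    (hproj : ∀ I : Ideal R, Module.Projective R I) : IsRDRing.{u, w} R := by
  refine fun M _ _ A => ⟨IsPureSubmodule.isRDSubmodule, fun hA φ a => ?_⟩
  rintro ⟨y, hy⟩
  let F : Submodule R (M ⧸ A) := Submodule.span R (Set.range fun j => Submodule.Quotient.mk (y j))
  have : Module.Finite R F := Module.Finite.span_of_finite _ (Set.finite_range _)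
  obtain ⟨s, hs⟩ := hA.exists_lift hR hR' hproj F.subtype
  let c : Fin φ.numVars → F := fun j => ⟨Submodule.Quotient.mk (y j), Submodule.subset_span ⟨j, rfl⟩⟩
  have hc : ∀ i, ∑ j, φ.A i j • c j = 0 := by
    intro i
    ext
    have : A.mkQ (∑ j, φ.A i j • y j) = 0 := by
      rw [hy, Submodule.mkQ_apply, Submodule.Quotient.mk_eq_zero]
      exact A.smul_mem _ a.2
    rw [map_sum] at this
    simpa [c] using this
  -- The residues `c j` solve the homogeneous system, hence so do their lifts. Subtracting these
  -- moves the solution into `A`.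
  refine ⟨fun j => ⟨y j - s (c j), ?_⟩, fun i => Subtype.ext ?_⟩
  · rw [← Submodule.Quotient.mk_eq_zero, Submodule.Quotient.mk_sub, hs]
    simp [c]
  · have h1 : ∑ j, φ.A i j • s (c j) = 0 := by
      simp only [← map_smul, ← map_sum, hc, map_zero]
    simp [smul_sub, Finset.sum_sub_distrib, hy, h1]

end Lifting

/-! ### The first Weyl algebra: normal forms, degree in `∂`, symmetries. -/

section WeylBasic

open Polynomial

/-- A copy of the first Weyl algebra on which the ring instance is found by unification alone. -/
def WeylRing (k : Type u) [Field k] : Type u := WeylAlgebra k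

namespace WeylRing

variable (k : Type u) [Field k]

noncomputable instance : Ring (WeylRing k) := inferInstanceAs (Ring (WeylAlgebra k))

noncomputable instance : Algebra k (WeylRing k) := inferInstanceAs (Algebra k (WeylAlgebra k))

/-- The quotient map from the free algebra. -/
noncomputable def mk : FreeAlgebra k (Fin 2) →ₐ[k] WeylRing k :=
  RingQuot.mkAlgHom k (WeylRel k)

/-- The generator `x` of the Weyl algebra. -/
noncomputable def x : WeylRing k := mk k (FreeAlgebra.ι k 0)

/-- The generator `∂` of the Weyl algebra. -/
noncomputable def d : WeylRing k := mk k (FreeAlgebra.ι k 1)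

theorem d_mul_x : d k * x k = x k * d k + 1 := by
  have : mk k (FreeAlgebra.ι k 1 * FreeAlgebra.ι k 0) =
      mk k (FreeAlgebra.ι k 0 * FreeAlgebra.ι k 1 + 1) := RingQuot.mkAlgHom_rel k WeylRel.comm
  rwa [map_mul, map_add, map_one, map_mul] at this

variable {k} {B : Type v} [Ring B] [Algebra k B]

/-- The universal property of the Weyl algebra. -/
noncomputable def lift (a b : B) (h : b * a = a * b + 1) : WeylRing k →ₐ[k] B :=
  RingQuot.liftAlgHom (A := FreeAlgebra k (Fin 2)) k (s := WeylRel k)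
    ⟨FreeAlgebra.lift k ![a, b], by
      rintro _ _ ⟨⟩
      simpa using h⟩

theorem lift_mk (a b : B) (h : b * a = a * b + 1) (r : FreeAlgebra k (Fin 2)) :
    lift a b h (mk k r) = FreeAlgebra.lift k ![a, b] r :=
  RingQuot.liftAlgHom_mkAlgHom_apply k _ _ _

@[simp]
theorem lift_x (a b : B) (h : b * a = a * b + 1) : lift a b h (x k) = a := by
  rw [x, lift_mk]
  simp

@[simp]
theorem lift_d (a b : B) (h : b * a = a * b + 1) : lift a b h (d k) = b := by
  rw [d, lift_mk]
  simp

theorem algHom_ext {f g : WeylRing k →ₐ[k] B} (hx : f (x k) = g (x k))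
    (hd : f (d k) = g (d k)) : f = g := by
  have h : f.comp (mk k) = g.comp (mk k) := by
    refine FreeAlgebra.hom_ext (funext fun i => ?_)
    fin_cases i
    · exact hx
    · exact hd
  exact RingQuot.ringQuot_ext' k (s := WeylRel k) f g h

theorem adjoin_eq_top : Algebra.adjoin k {x k, d k} = ⊤ := by
  let A := Algebra.adjoin k {x k, d k}
  have hx : x k ∈ A := Algebra.subset_adjoin (by simp)
  have hd : d k ∈ A := Algebra.subset_adjoin (by simp)
  let f : WeylRing k →ₐ[k] A := lift ⟨x k, hx⟩ ⟨d k, hd⟩ (Subtype.ext (d_mul_x k))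
  have hf : A.val.comp f = AlgHom.id k _ := algHom_ext (by simp [f]) (by simp [f])
  refine eq_top_iff.2 fun r _ => ?_
  have := AlgHom.congr_fun hf r
  simp only [AlgHom.comp_apply, AlgHom.id_apply] at this
  rw [← this]
  exact (f r).2

/-- The polynomials in `x`. -/
noncomputable def polyX : k[X] →ₐ[k] WeylRing k := aeval (x k)

/-- The polynomials in `∂`. -/
noncomputable def polyD : k[X] →ₐ[k] WeylRing k := aeval (d k)

@[simp]
theorem polyX_X : polyX (k := k) X = x k := aeval_X _

@[simp]
theorem polyD_X : polyD (k := k) X = d k := aeval_X _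

theorem mem_of_polyX_mem_of_d_mem {A : Subring (WeylRing k)} (hX : ∀ p, polyX p ∈ A)
    (hd : d k ∈ A) (r : WeylRing k) : r ∈ A := by
  let A' : Subalgebra k (WeylRing k) :=
    { A with
      algebraMap_mem' := fun c => by
        have := hX (C c)
        rwa [polyX, aeval_C] at this }
  have hle : Algebra.adjoin k {x k, d k} ≤ A' := Algebra.adjoin_le (by
    rintro _ (rfl | rfl)
    · exact polyX_X (k := k) ▸ hX X
    · exact hd)
  rw [adjoin_eq_top] at hle
  exact hle trivial

theorem d_mul_polyX (p : k[X]) :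
    d k * polyX p = polyX p * d k + polyX (derivative p) := by
  induction p using Polynomial.induction_on' with
  | add p q hp hq => simp only [map_add, mul_add, add_mul, hp, hq]; abel
  | monomial n c =>
    induction n with
    | zero =>
      simp only [monomial_zero_left, derivative_C, map_zero, add_zero]
      rw [polyX, aeval_C, Algebra.commutes]
    | succ n ih =>
      rw [← monomial_mul_X, map_mul, derivative_mul, map_add, map_mul, map_mul, ← mul_assoc, ih,
        add_mul, mul_assoc, polyX_X, d_mul_x]
      simp only [derivative_X, map_one, mul_one, mul_add, ← mul_assoc]
      abel

/-- The coefficientwise derivative on `k[x][y]`. -/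
noncomputable def coeffDerivative : k[X][X] →ₗ[k] k[X][X] :=
  lsum fun i => (monomial i).restrictScalars k ∘ₗ derivative

@[simp]
theorem coeff_coeffDerivative (f : k[X][X]) (n : ℕ) :
    (coeffDerivative f).coeff n = derivative (f.coeff n) := by
  simp only [coeffDerivative, lsum_apply, Polynomial.sum, finsetSum_coeff]
  simp [coeff_monomial, Finset.sum_ite_eq']
  intro h
  simp [h]

/-- The action of the Weyl algebra on `k[x][y]` where `∂` acts as `y + d/dx`. -/
noncomputable def action : WeylRing k →ₐ[k] Module.End k k[X][X] :=
  lift (B := Module.End k k[X][X]) (LinearMap.mulLeft k (C X : k[X][X]))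
    (LinearMap.mulLeft k (X : k[X][X]) + coeffDerivative) (by
    refine LinearMap.ext fun f => Polynomial.ext fun n => ?_
    cases n <;> simp [add_mul, mul_add, coeff_X_mul, coeff_C_mul, mul_left_comm (X : k[X][X]) (C X)] <;>
      ring)

theorem action_d (f : k[X][X]) : action (d k) f = X * f + coeffDerivative f := by
  simp [action]

theorem action_polyX (p : k[X]) (f : k[X][X]) : action (polyX p) f = C p * f := by
  induction p using Polynomial.induction_on' with
  | add p q hp hq => simp [add_mul, hp, hq]
  | monomial n c =>
    induction n generalizing f with
    | zero =>
      rw [monomial_zero_left, polyX, aeval_C, AlgHom.commutes]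
      ext
      simp [Module.algebraMap_end_apply, smul_eq_C_mul]
    | succ n ih =>
      rw [← monomial_mul_X, map_mul, map_mul, Module.End.mul_apply, ih, polyX_X, action, lift_x,
        LinearMap.mulLeft_apply, ← mul_assoc, C_mul]

/-- The normal form of an element of the Weyl algebra: `∑ pᵢ(x) ∂^i ↦ ∑ pᵢ y^i`. -/
noncomputable def symbol : WeylRing k →ₗ[k] k[X][X] :=
  LinearMap.applyₗ (1 : k[X][X]) ∘ₗ action.toLinearMap

theorem symbol_apply (r : WeylRing k) : symbol r = action r 1 := rfl

theorem symbol_mul (r s : WeylRing k) : symbol (r * s) = action r (symbol s) := by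
  simp [symbol_apply]

theorem symbol_polyX_mul (p : k[X]) (s : WeylRing k) :
    symbol (polyX p * s) = C p * symbol s := by
  rw [symbol_mul, action_polyX]

theorem symbol_d_pow (n : ℕ) : symbol (d k ^ n) = X ^ n := by
  induction n with
  | zero => simp [symbol_apply]
  | succ n ih =>
    rw [pow_succ', symbol_mul, ih, action_d]
    have : coeffDerivative (X ^ n : k[X][X]) = 0 := by
      ext i : 1
      rw [coeff_coeffDerivative, coeff_X_pow]
      split <;> simp
    rw [this, add_zero, pow_succ']

/-- The element of the Weyl algebra with a given normal form. -/
noncomputable def ofSymbol : k[X][X] →ₗ[k] WeylRing k :=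
  lsum fun i => LinearMap.mulRight k (d k ^ i) ∘ₗ polyX.toLinearMap

theorem ofSymbol_monomial (n : ℕ) (p : k[X]) :
    ofSymbol (monomial n p) = polyX p * d k ^ n := by
  simp [ofSymbol]

theorem symbol_ofSymbol (f : k[X][X]) : symbol (ofSymbol f) = f := by
  induction f using Polynomial.induction_on' with
  | add p q hp hq => simp [hp, hq]
  | monomial n p =>
    rw [ofSymbol_monomial, symbol_polyX_mul, symbol_d_pow, C_mul_X_pow_eq_monomial]

/-- The range contains `1` and is stable under left multiplication by `k[x]` and, thanks to `∂ p = p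
∂ + p'`, by `∂`. -/
theorem ofSymbol_surjective : Function.Surjective (ofSymbol (k := k)) := by
  let L := LinearMap.range (ofSymbol (k := k))
  have hmon : ∀ {r : WeylRing k}, (∀ n p, r * ofSymbol (monomial n p) ∈ L) →
      ∀ s ∈ L, r * s ∈ L := by
    rintro r hr _ ⟨f, rfl⟩
    induction f using Polynomial.induction_on' with
    | add p q hp hq => rw [map_add, mul_add]; exact L.add_mem hp hq
    | monomial n p => exact hr n p
  let A : Subring (WeylRing k) :=
    { carrier := {r | ∀ s ∈ L, r * s ∈ L}
      mul_mem' := fun ha hb s hs => by rw [mul_assoc]; exact ha _ (hb s hs)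
      one_mem' := fun s hs => by rwa [one_mul]
      add_mem' := fun ha hb s hs => by rw [add_mul]; exact L.add_mem (ha s hs) (hb s hs)
      zero_mem' := fun s _ => by rw [zero_mul]; exact L.zero_mem
      neg_mem' := fun ha s hs => by rw [neg_mul]; exact L.neg_mem (ha s hs) }
  intro r
  have h1 : (1 : WeylRing k) ∈ L := ⟨monomial 0 1, by rw [ofSymbol_monomial]; simp⟩
  have hr : r ∈ A := by
    refine mem_of_polyX_mem_of_d_mem (A := A) (fun p => ?_) ?_ r
    · refine hmon fun n q => ?_
      exact ⟨monomial n (p * q), by rw [ofSymbol_monomial, ofSymbol_monomial, map_mul, mul_assoc]⟩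
    · refine hmon fun n p => ?_
      refine ⟨monomial (n + 1) p + monomial n (derivative p), ?_⟩
      rw [map_add, ofSymbol_monomial, ofSymbol_monomial, ofSymbol_monomial, ← mul_assoc,
        d_mul_polyX, add_mul, pow_succ', mul_assoc]
  have h2 := hr 1 h1
  rwa [mul_one] at h2

theorem ofSymbol_symbol (r : WeylRing k) : ofSymbol (symbol r) = r := by
  obtain ⟨f, rfl⟩ := ofSymbol_surjective r
  rw [symbol_ofSymbol]

theorem symbol_eq_zero_iff {r : WeylRing k} : symbol r = 0 ↔ r = 0 :=
  ⟨fun h => by rw [← ofSymbol_symbol r, h, map_zero], fun h => by rw [h, map_zero]⟩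

theorem natDegree_action_d_pow_le {f : k[X][X]} {m : ℕ} (hf : f.natDegree ≤ m) (i : ℕ) :
    (action (d k ^ i) f).natDegree ≤ i + m ∧ (action (d k ^ i) f).coeff (i + m) = f.coeff m := by
  induction i with
  | zero => simpa using hf
  | succ i ih =>
    obtain ⟨h1, h2⟩ := ih
    rw [pow_succ', map_mul, Module.End.mul_apply, action_d]
    set g := action (d k ^ i) f
    refine ⟨natDegree_le_iff_coeff_eq_zero.2 fun N hN => ?_, ?_⟩
    · obtain ⟨N, rfl⟩ : ∃ M, N = M + 1 := ⟨N - 1, by omega⟩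
      rw [coeff_add, coeff_X_mul, coeff_coeffDerivative,
        coeff_eq_zero_of_natDegree_lt (n := N) (by omega),
        coeff_eq_zero_of_natDegree_lt (by omega)]
      simp
    · rw [add_right_comm, coeff_add, coeff_X_mul, coeff_coeffDerivative, h2,
        coeff_eq_zero_of_natDegree_lt (n := i + m + 1) (by omega)]
      simp

/-- Multiplication is compatible with the filtration by the degree in `∂`, and leading
coefficients multiply. -/
theorem natDegree_symbol_mul_le {r s : WeylRing k} {n m : ℕ} (hr : (symbol r).natDegree ≤ n)
    (hs : (symbol s).natDegree ≤ m) :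
    (symbol (r * s)).natDegree ≤ n + m ∧
      (symbol (r * s)).coeff (n + m) = (symbol r).coeff n * (symbol s).coeff m := by
  rw [symbol_mul]
  have hsum : action r (symbol s) =
      ∑ i ∈ Finset.range (n + 1), C ((symbol r).coeff i) * action (d k ^ i) (symbol s) := by
    conv_lhs => rw [← ofSymbol_symbol r, as_sum_range' (symbol r) (n + 1) (by omega)]
    simp only [map_sum, LinearMap.sum_apply, ofSymbol_monomial, map_mul, Module.End.mul_apply,
      action_polyX]
  rw [hsum]
  have hi := natDegree_action_d_pow_le hs
  refine ⟨natDegree_sum_le_of_forall_le _ _ fun i hin => ?_, ?_⟩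
  · refine (natDegree_C_mul_le _ _).trans ((hi i).1.trans ?_)
    have := Finset.mem_range.1 hin
    omega
  · rw [finsetSum_coeff, Finset.sum_range_succ, Finset.sum_eq_zero, zero_add, coeff_C_mul,
      (hi n).2]
    intro i hin
    have := Finset.mem_range.1 hin
    rw [coeff_C_mul, coeff_eq_zero_of_natDegree_lt (n := n + m), mul_zero]
    exact (hi i).1.trans_lt (by omega)

instance : IsDomain (WeylRing k) := by
  have hnt : Nontrivial (WeylRing k) := ⟨1, 0, fun h => by
    have := congrArg symbol h
    simp [symbol_apply] at this⟩
  have hnz : NoZeroDivisors (WeylRing k) := ⟨fun {r s} h => by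
    by_contra! hne
    have := (natDegree_symbol_mul_le (le_refl (symbol r).natDegree)
      (le_refl (symbol s).natDegree)).2
    rw [h, map_zero, coeff_zero, eq_comm, mul_eq_zero] at this
    simp only [coeff_natDegree, leadingCoeff_eq_zero, symbol_eq_zero_iff] at this
    tauto⟩
  exact NoZeroDivisors.to_isDomain _

/-- The anti-automorphism `x ↦ x`, `∂ ↦ -∂`. -/
noncomputable def opHom : WeylRing k →ₐ[k] (WeylRing k)ᵐᵒᵖ :=
  lift (MulOpposite.op (x k)) (MulOpposite.op (-d k)) (by
    rw [← MulOpposite.op_mul, ← MulOpposite.op_mul, ← MulOpposite.op_one, ← MulOpposite.op_add,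
      neg_mul, mul_neg, d_mul_x]
    simp)

/-- The Fourier transform `x ↦ ∂`, `∂ ↦ -x`. -/
noncomputable def fourierHom : WeylRing k →ₐ[k] WeylRing k :=
  lift (d k) (-x k) (by rw [neg_mul, mul_neg, d_mul_x]; simp)

/-- The Fourier transform as an automorphism of the Weyl algebra. -/
noncomputable def fourier : WeylRing k ≃ₐ[k] WeylRing k :=
  AlgEquiv.ofAlgHom fourierHom (lift (-d k) (x k) (by rw [neg_mul, mul_neg, d_mul_x]; simp))
    (algHom_ext (by simp [fourierHom]) (by simp [fourierHom]))
    (algHom_ext (by simp [fourierHom]) (by simp [fourierHom]))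

theorem fourier_polyX (p : k[X]) : fourier (polyX p) = polyD p := by
  have : (fourier : WeylRing k ≃ₐ[k] _).toAlgHom.comp polyX = polyD := by
    refine Polynomial.algHom_ext ?_
    change fourierHom (polyX X) = polyD X
    rw [polyX_X, polyD_X, fourierHom, lift_x]
  exact AlgHom.congr_fun this p

theorem unop_opHom_unop_opHom (r : WeylRing k) : (opHom (opHom r).unop).unop = r := by
  have : ((AlgEquiv.opOp k (WeylRing k)).symm.toAlgHom.comp (AlgHom.op opHom)).comp opHom =
      AlgHom.id k (WeylRing k) :=
    algHom_ext (by simp [opHom, AlgHom.comp_apply]) (by simp [opHom, AlgHom.comp_apply])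
  exact AlgHom.congr_fun this r

/-- The anti-automorphism `x ↦ x`, `∂ ↦ -∂` as an isomorphism onto the opposite ring. -/
noncomputable def opEquiv : WeylRing k ≃+* (WeylRing k)ᵐᵒᵖ where
  toFun := opHom
  invFun s := (opHom s.unop).unop
  left_inv := unop_opHom_unop_opHom
  right_inv s := MulOpposite.unop_injective (unop_opHom_unop_opHom s.unop)
  map_mul' := map_mul _
  map_add' := map_add _

end WeylRing

end WeylBasic

/-! ### Chain conditions from rank functions and localizations. -/

section ChainConditions

variable {R : Type u} [Ring R]

theorem isNoetherianRing_of_strictAnti {δ : Ideal R → ℕ}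
    (hδ : ∀ I J : Ideal R, I ≠ ⊥ → I < J → δ J < δ I) : IsNoetherianRing R := by
  classical
  -- The hypothesis on `δ` excludes the zero ideal, which therefore gets the value `⊤`.
  let f : Ideal R → ℕ∞ := fun I => if I = ⊥ then ⊤ else (δ I : ℕ∞)
  have hf : StrictAnti f := by
    intro I J hIJ
    have hJ : J ≠ ⊥ := (bot_le.trans_lt hIJ).ne'
    by_cases hI : I = ⊥
    · simp [f, hI, hJ]
    · simpa [f, hI, hJ] using hδ I J hI hIJ
  have : WellFoundedGT (Ideal R) := hf.wellFoundedGT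
  exact isNoetherian_iff'.2 this

theorem hasArtinianQuotients_of_strictAnti {δ : Ideal R → ℕ}
    (hδ : ∀ I J : Ideal R, I ≠ ⊥ → I < J → δ J < δ I) : HasArtinianQuotients R := by
  intro r hr
  let I : Ideal R := Ideal.span {r}
  have hI : I ≠ ⊥ := by simpa [I] using hr
  -- The truncated subtraction loses nothing, since every preimage contains `I` and so has `δ` at
  -- most `δ I`.
  let f : Submodule R (R ⧸ I) → ℕ := fun N => δ I - δ (N.comap I.mkQ)
  have hle : ∀ N : Submodule R (R ⧸ I), I ≤ N.comap I.mkQ := fun N i hi => by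
    have : I.mkQ i = 0 := (Submodule.Quotient.mk_eq_zero I).2 hi
    simp [this]
  have hf : StrictMono f := by
    intro N N' hN
    have hlt : N.comap I.mkQ < N'.comap I.mkQ :=
      (Submodule.comap_strictMono_of_surjective I.mkQ_surjective) hN
    have hne : N.comap I.mkQ ≠ ⊥ := (bot_lt_iff_ne_bot.2 hI |>.trans_le (hle N)).ne'
    have h1 := hδ _ _ hne hlt
    have h2 : δ (N.comap I.mkQ) ≤ δ I := by
      rcases (hle N).eq_or_lt with h | h
      · rw [← h]
      · exact (hδ _ _ hI h).le
    change δ I - _ < δ I - _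
    omega
  exact hf.wellFoundedLT

/-- A ring homomorphism from a commutative ring whose nonzero elements form an Ore set, such that
the localization at this Ore set is a left principal ideal ring. -/
structure IsLocallyPrincipal {A : Type v} [CommRing A] (P : A →+* R) : Prop where
  injective : Function.Injective P
  left_ore : ∀ (r : R) {p : A}, p ≠ 0 → ∃ p' r', p' ≠ 0 ∧ P p' * r = r' * P p
  right_ore : ∀ (r : R) {p : A}, p ≠ 0 → ∃ p' r', p' ≠ 0 ∧ r * P p' = P p * r'
  exists_generator : ∀ I : Ideal R, I ≠ ⊥ →
    ∃ g ∈ I, g ≠ 0 ∧ ∀ a ∈ I, ∃ p, p ≠ 0 ∧ P p * a ∈ Ideal.span {g}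
  exists_rank : ∃ ρ : Ideal R → ℕ, ∀ I J, I ≠ ⊥ → I ≤ J →
    ρ J ≤ ρ I ∧ (ρ I = ρ J → ∀ a ∈ J, ∃ p, p ≠ 0 ∧ P p * a ∈ I)

theorem IsLocallyPrincipal.ringEquiv_comp {R' : Type w} [Ring R'] {A : Type v} [CommRing A]
    {P : A →+* R} (hP : IsLocallyPrincipal P) (e : R ≃+* R') :
    IsLocallyPrincipal ((e : R →+* R').comp P) := by
  have hmem : ∀ (I : Ideal R') (a : R'), a ∈ I → e.symm a ∈ I.comap (e : R →+* R') := by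
    intro I a ha
    change e (e.symm a) ∈ I
    rwa [e.apply_symm_apply]
  have hne : ∀ {I : Ideal R'}, I ≠ ⊥ → I.comap (e : R →+* R') ≠ ⊥ := by
    intro I hI
    obtain ⟨i, hi, h0⟩ := (Submodule.ne_bot_iff I).1 hI
    exact (Submodule.ne_bot_iff _).2 ⟨e.symm i, hmem I i hi, by simpa using h0⟩
  refine ⟨e.injective.comp hP.injective, fun r p hp => ?_, fun r p hp => ?_, fun I hI => ?_, ?_⟩
  · obtain ⟨p', r', h, h'⟩ := hP.left_ore (e.symm r) hp
    exact ⟨p', e r', h, by simpa using congrArg e h'⟩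
  · obtain ⟨p', r', h, h'⟩ := hP.right_ore (e.symm r) hp
    exact ⟨p', e r', h, by simpa using congrArg e h'⟩
  · obtain ⟨g, hg, hg0, h⟩ := hP.exists_generator _ (hne hI)
    refine ⟨e g, hg, by simpa using hg0, fun a ha => ?_⟩
    obtain ⟨p, hp, h'⟩ := h (e.symm a) (hmem _ a ha)
    refine ⟨p, hp, ?_⟩
    obtain ⟨c, hc⟩ := Ideal.mem_span_singleton'.1 h'
    exact Ideal.mem_span_singleton'.2 ⟨e c, by simpa using congrArg e hc⟩
  · obtain ⟨ρ, hρ⟩ := hP.exists_rank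
    refine ⟨fun I => ρ (I.comap (e : R →+* R')), fun I J hI hIJ => ?_⟩
    obtain ⟨h1, h2⟩ := hρ _ _ (hne hI) (Ideal.comap_mono (f := (e : R →+* R')) hIJ)
    refine ⟨h1, fun h a ha => ?_⟩
    obtain ⟨p, hp, h'⟩ := h2 h (e.symm a) (hmem _ a ha)
    exact ⟨p, hp, by simpa [Ideal.mem_comap] using h'⟩

/-- Take the sum of the two ranks. If it agrees on `I ≤ J`, each `a ∈ J` has multiples `P p * a` and
`Q q * a` in `I`, and comaximality puts `a` itself in `I`. -/
theorem IsLocallyPrincipal.exists_strictAnti {A B : Type v} [CommRing A] [CommRing B]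
    {P : A →+* R} {Q : B →+* R} (hP : IsLocallyPrincipal P) (hQ : IsLocallyPrincipal Q)
    (hPQ : ∀ p q, p ≠ 0 → q ≠ 0 → ∃ u v, u * P p + v * Q q = 1) :
    ∃ δ : Ideal R → ℕ, ∀ I J : Ideal R, I ≠ ⊥ → I < J → δ J < δ I := by
  obtain ⟨ρ, hρ⟩ := hP.exists_rank
  obtain ⟨σ, hσ⟩ := hQ.exists_rank
  refine ⟨fun I => ρ I + σ I, fun I J hI hIJ => ?_⟩
  obtain ⟨h1, h2⟩ := hρ I J hI hIJ.le
  obtain ⟨h3, h4⟩ := hσ I J hI hIJ.le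
  refine lt_of_le_of_ne (add_le_add h1 h3) fun h => hIJ.not_ge fun a ha => ?_
  have h : ρ J + σ J = ρ I + σ I := h
  obtain ⟨p, hp, hpa⟩ := h2 (by omega) a ha
  obtain ⟨q, hq, hqa⟩ := h4 (by omega) a ha
  obtain ⟨u, v, huv⟩ := hPQ p q hp hq
  rw [← one_mul a, ← huv, add_mul, mul_assoc, mul_assoc]
  exact I.add_mem (I.mul_mem_left _ hpa) (I.mul_mem_left _ hqa)

end ChainConditions

/-! ### Localizations of the Weyl algebra, comaximality, simplicity. -/

section WeylLocal

open Polynomial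

namespace WeylRing

variable {k : Type u} [Field k]

theorem symbol_polyX (p : k[X]) : symbol (polyX p) = C p := by
  rw [symbol_apply, action_polyX, mul_one]

theorem polyX_injective : Function.Injective (polyX (k := k)) := fun p q h => by
  have := congrArg symbol h
  rwa [symbol_polyX, symbol_polyX, C_inj] at this

theorem exists_polyX_right_ore (r : WeylRing k) {p : k[X]} (hp : p ≠ 0) :
    ∃ p' r', p' ≠ 0 ∧ r * polyX p' = polyX p * r' := by
  let A : Subring (WeylRing k) :=
    { carrier := {r | ∀ p : k[X], p ≠ 0 → ∃ p' r', p' ≠ 0 ∧ r * polyX p' = polyX p * r'}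
      mul_mem' := by
        intro a b ha hb p hp
        obtain ⟨p₁, r₁, h₁, e₁⟩ := ha p hp
        obtain ⟨p₂, r₂, h₂, e₂⟩ := hb p₁ h₁
        exact ⟨p₂, r₁ * r₂, h₂, by rw [mul_assoc, e₂, ← mul_assoc, e₁, mul_assoc]⟩
      one_mem' := fun p hp => ⟨p, 1, hp, by rw [one_mul, mul_one]⟩
      add_mem' := by
        intro a b ha hb p hp
        obtain ⟨p₁, r₁, h₁, e₁⟩ := ha p hp
        obtain ⟨p₂, r₂, h₂, e₂⟩ := hb p hp
        refine ⟨p₁ * p₂, r₁ * polyX p₂ + r₂ * polyX p₁, mul_ne_zero h₁ h₂, ?_⟩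
        rw [add_mul, map_mul, ← mul_assoc, e₁, ← map_mul, mul_comm p₁, map_mul, ← mul_assoc, e₂,
          mul_add, mul_assoc, mul_assoc]
      zero_mem' := fun p hp => ⟨p, 0, hp, by rw [zero_mul, mul_zero]⟩
      neg_mem' := by
        intro a ha p hp
        obtain ⟨p₁, r₁, h₁, e₁⟩ := ha p hp
        exact ⟨p₁, -r₁, h₁, by rw [neg_mul, e₁, mul_neg]⟩ }
  refine mem_of_polyX_mem_of_d_mem (A := A) (fun q p hp => ?_) (fun p hp => ?_) r p hp
  · exact ⟨p, polyX q, hp, by rw [← map_mul, ← map_mul, mul_comm]⟩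
  -- Squaring leaves a factor `p` after differentiation: `∂ p² = p² ∂ + 2 p p' = p (p ∂ + 2 p')`.
  · refine ⟨p ^ 2, polyX p * d k + polyX (2 * derivative p), pow_ne_zero 2 hp, ?_⟩
    rw [d_mul_polyX, mul_add, ← mul_assoc, ← map_mul, ← map_mul, derivative_pow]
    congr 2
    · rw [sq]
    · simp only [Nat.add_one_sub_one, pow_one, Nat.cast_ofNat, map_ofNat]
      ring

theorem opHom_polyX (p : k[X]) : opHom (polyX p) = MulOpposite.op (polyX p) := by
  induction p using Polynomial.induction_on' with
  | add p q hp hq => rw [map_add, map_add, hp, hq, MulOpposite.op_add]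
  | monomial n c =>
    rw [← C_mul_X_pow_eq_monomial, map_mul, map_mul, map_pow, map_pow, polyX_X, opHom, lift_x,
      polyX, aeval_C, AlgHom.commutes, MulOpposite.algebraMap_apply, ← MulOpposite.op_pow,
      ← MulOpposite.op_mul, Algebra.commutes]

theorem opHom_polyD (p : k[X]) :
    opHom (polyD p) = MulOpposite.op (polyD (p.comp (-X))) := by
  induction p using Polynomial.induction_on' with
  | add p q hp hq => rw [map_add, map_add, hp, hq, add_comp, map_add, MulOpposite.op_add]
  | monomial n c =>
    rw [← C_mul_X_pow_eq_monomial, map_mul, map_mul, map_pow, map_pow, polyD_X, opHom, lift_d,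
      mul_comp, pow_comp, X_comp, C_comp, map_mul, map_pow, map_neg, polyD_X,
      polyD, aeval_C, AlgHom.commutes, MulOpposite.algebraMap_apply, ← MulOpposite.op_pow,
      ← MulOpposite.op_mul, Algebra.commutes]

theorem exists_polyX_left_ore (r : WeylRing k) {p : k[X]} (hp : p ≠ 0) :
    ∃ p' r', p' ≠ 0 ∧ polyX p' * r = r' * polyX p := by
  obtain ⟨p', r', h, h'⟩ := exists_polyX_right_ore (opHom r).unop hp
  refine ⟨p', (opHom r').unop, h, ?_⟩
  have := congrArg (fun s => (opHom s).unop) h'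
  simpa [opHom_polyX, unop_opHom_unop_opHom] using this

theorem exists_natDegree_le (I : Ideal (WeylRing k)) (hI : I ≠ ⊥) :
    ∃ g ∈ I, g ≠ 0 ∧ ∀ a ∈ I, a ≠ 0 → (symbol g).natDegree ≤ (symbol a).natDegree := by
  classical
  obtain ⟨i, hi, h0⟩ := (Submodule.ne_bot_iff I).1 hI
  have hex : ∃ n, ∃ g ∈ I, g ≠ 0 ∧ (symbol g).natDegree = n := ⟨_, i, hi, h0, rfl⟩
  obtain ⟨g, hg, hg0, h⟩ := Nat.find_spec hex
  exact ⟨g, hg, hg0, fun a ha ha0 => h ▸ Nat.find_min' hex ⟨a, ha, ha0, rfl⟩⟩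

theorem natDegree_symbol_d_pow_mul (n : ℕ) (g : WeylRing k) :
    (symbol (d k ^ n * g)).natDegree ≤ n + (symbol g).natDegree ∧
      (symbol (d k ^ n * g)).coeff (n + (symbol g).natDegree) = (symbol g).leadingCoeff := by
  have := natDegree_symbol_mul_le (r := d k ^ n) (s := g) (n := n)
    (by rw [symbol_d_pow, natDegree_X_pow]) le_rfl
  rwa [symbol_d_pow, coeff_X_pow_self, one_mul] at this

/-- Division with remainder in the localization of the Weyl algebra at the polynomials in `x`. -/
theorem exists_polyX_mul_mem_span {I : Ideal (WeylRing k)} {g : WeylRing k} (hg : g ∈ I)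
    (hg0 : g ≠ 0) (hmin : ∀ a ∈ I, a ≠ 0 → (symbol g).natDegree ≤ (symbol a).natDegree)
    {a : WeylRing k} (ha : a ∈ I) : ∃ p : k[X], p ≠ 0 ∧ polyX p * a ∈ Ideal.span {g} := by
  induction hn : (symbol a).natDegree using Nat.strong_induction_on generalizing a with
  | _ n ih =>
  by_cases ha0 : a = 0
  · exact ⟨1, one_ne_zero, by simp [ha0]⟩
  obtain ⟨m, hm⟩ := Nat.exists_eq_add_of_le' (hmin a ha ha0)
  set c := (symbol g).leadingCoeff
  set e := (symbol a).leadingCoeff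
  have hc : c ≠ 0 := by simpa [c, symbol_eq_zero_iff] using hg0
  -- Cross multiplication by the leading coefficients cancels the terms of top degree in `∂`.
  let b := polyX c * a - polyX e * (d k ^ m * g)
  have hbI : b ∈ I := I.sub_mem (I.mul_mem_left _ ha) (I.mul_mem_left _ (I.mul_mem_left _ hg))
  obtain ⟨p, hp, hpb⟩ : ∃ p : k[X], p ≠ 0 ∧ polyX p * b ∈ Ideal.span {g} := by
    by_cases hb0 : b = 0
    · exact ⟨1, one_ne_zero, by simp [hb0]⟩
    refine ih _ ?_ hbI rfl
    obtain ⟨h1, h2⟩ := natDegree_symbol_d_pow_mul m g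
    rw [← hm, hn] at h1 h2
    have hb : symbol b = C c * symbol a - C e * symbol (d k ^ m * g) := by
      rw [map_sub, symbol_polyX_mul, symbol_polyX_mul]
    have hle : (symbol b).natDegree ≤ n := by
      rw [hb]
      exact (natDegree_sub_le _ _).trans (max_le ((natDegree_C_mul_le _ _).trans hn.le)
        ((natDegree_C_mul_le _ _).trans h1))
    refine lt_of_le_of_ne hle fun hbn => hb0 ?_
    rw [← symbol_eq_zero_iff, ← leadingCoeff_eq_zero, leadingCoeff, hbn, hb, coeff_sub,
      coeff_C_mul, coeff_C_mul, h2, ← hn]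
    change c * e - e * c = 0
    ring
  refine ⟨p * c, mul_ne_zero hp hc, ?_⟩
  have : polyX (p * c) * a = polyX p * b + polyX p * polyX e * d k ^ m * g := by
    simp only [b, mul_sub, map_mul, mul_assoc, sub_add_cancel]
  rw [this]
  exact Ideal.add_mem _ hpb (Ideal.mul_mem_left _ _ (Ideal.mem_span_singleton_self g))

theorem isLocallyPrincipal_polyX : IsLocallyPrincipal (polyX (k := k)).toRingHom where
  injective := polyX_injective
  left_ore := exists_polyX_left_ore
  right_ore := exists_polyX_right_ore
  exists_generator I hI := by
    obtain ⟨g, hg, hg0, h⟩ := exists_natDegree_le I hI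
    exact ⟨g, hg, hg0, fun a ha => exists_polyX_mul_mem_span hg hg0 h ha⟩
  exists_rank := by
    choose g hg hg0 hmin using exists_natDegree_le (k := k)
    classical
    -- The rank is the least degree in `∂` of a nonzero element. If `I ≤ J` have equal rank, the
    -- chosen element of `I` also has least degree in `J`.
    refine ⟨fun I => if hI : I ≠ ⊥ then (symbol (g I hI)).natDegree else 0,
      fun I J hI hIJ => ?_⟩
    have hJ : J ≠ ⊥ := fun h => hI (eq_bot_iff.2 (h ▸ hIJ))
    simp only [dif_pos hI, dif_pos hJ]
    refine ⟨hmin J hJ _ (hIJ (hg I hI)) (hg0 I hI), fun h a ha => ?_⟩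
    obtain ⟨p, hp, h'⟩ := exists_polyX_mul_mem_span (hIJ (hg I hI)) (hg0 I hI)
      (fun b hb hb0 => h.le.trans (hmin J hJ b hb hb0)) ha
    exact ⟨p, hp, (Ideal.span_singleton_le_iff_mem I).2 (hg I hI) h'⟩

theorem isLocallyPrincipal_polyD : IsLocallyPrincipal (polyD (k := k)).toRingHom := by
  have := (isLocallyPrincipal_polyX (k := k)).ringEquiv_comp fourier.toRingEquiv
  convert this using 1
  exact RingHom.ext fun p => (fourier_polyX p).symm

theorem polyX_C (c : k) : polyX (C c) = algebraMap k (WeylRing k) c := aeval_C _ _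

theorem polyD_eq_sum (h : k[X]) :
    polyD h = ∑ i ∈ Finset.range (h.natDegree + 1), polyX (C (h.coeff i)) * d k ^ i := by
  simp only [polyD, aeval_eq_sum_range, polyX_C, Algebra.smul_def]

theorem d_pow_mul_x (n : ℕ) : d k ^ n * x k = x k * d k ^ n + n * d k ^ (n - 1) := by
  induction n with
  | zero => simp
  | succ n ih =>
    have h : (n : WeylRing k) * (d k * d k ^ (n - 1)) = n * d k ^ n := by
      cases n with
      | zero => simp
      | succ n => rw [← pow_succ', Nat.add_sub_cancel]
    rw [pow_succ', mul_assoc, ih, mul_add, ← mul_assoc, d_mul_x, ← mul_assoc,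
      ← Nat.cast_comm, mul_assoc (n : WeylRing k), h, Nat.add_sub_cancel, Nat.cast_succ]
    noncomm_ring

theorem mul_x_sub_x_mul (r : WeylRing k) :
    r * x k - x k * r = ofSymbol (derivative (symbol r)) := by
  conv_lhs => rw [← ofSymbol_symbol r]
  induction symbol r using Polynomial.induction_on' with
  | add p q hp hq => rw [map_add, map_add, map_add, ← hp, ← hq]; noncomm_ring
  | monomial n p =>
    have h : polyX p * x k = x k * polyX p := by rw [← polyX_X, ← map_mul, ← map_mul, mul_comm]
    rw [derivative_monomial, ofSymbol_monomial, ofSymbol_monomial, mul_assoc, d_pow_mul_x, mul_add,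
      ← mul_assoc, h, mul_assoc, add_sub_cancel_left, map_mul, map_natCast, mul_assoc]

variable [CharZero k]

/-- An element of a module over the Weyl algebra that is killed by a nonzero polynomial in `x` and
by a nonzero polynomial in `∂` vanishes. -/
theorem eq_zero_of_polyX_smul_of_polyD_smul {V : Type v} [AddCommGroup V] [Module (WeylRing k) V]
    {v : V} {p h : k[X]} (hp : p ≠ 0) (hh : h ≠ 0) (hpv : polyX p • v = 0)
    (hhv : polyD h • v = 0) : v = 0 := by
  classical
  by_contra hv
  let L := Submodule.span (WeylRing k) {v}
  -- With `q` of least degree killing some nonzero `w ∈ R v`, its derivative `q'` kills no nonzero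
  -- element of `R v`.
  have hex : ∃ n, ∃ q : k[X], q ≠ 0 ∧ q.natDegree = n ∧ ∃ w ∈ L, w ≠ 0 ∧ polyX q • w = 0 :=
    ⟨_, p, hp, rfl, v, Submodule.mem_span_singleton_self v, hv, hpv⟩
  obtain ⟨q, hq, hqn, w, hwL, hw, hqw⟩ := Nat.find_spec hex
  have hlow : ∀ f : k[X], f ≠ 0 → f.natDegree < q.natDegree → ∀ z ∈ L, z ≠ 0 →
      polyX f • z ≠ 0 := fun f hf hfq z hz hz0 h0 =>
    Nat.find_min hex (hqn ▸ hfq) ⟨f, hf, rfl, z, hz, hz0, h0⟩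
  have hC : ∀ c : k, c ≠ 0 → ∀ z : V, polyX (C c) • z = 0 → z = 0 := by
    intro c hc z hz
    have := congrArg (fun z => polyX (C c⁻¹) • z) hz
    simpa [smul_smul, ← map_mul, ← C_mul, hc] using this
  have hq1 : 0 < q.natDegree := by
    rw [Nat.pos_iff_ne_zero]
    intro h0
    rw [eq_C_of_natDegree_eq_zero h0] at hqw hq
    exact hw (hC _ (by simpa using hq) w hqw)
  have hq' : derivative q ≠ 0 := fun h0 =>
    hq1.ne' (derivative_eq_zero.1 h0)
  have hpow : ∀ j, polyX (derivative q ^ j) • w ≠ 0 := by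
    intro j
    induction j with
    | zero => simpa using hw
    | succ j ih =>
      rw [pow_succ', map_mul, mul_smul]
      exact hlow _ hq' (natDegree_derivative_lt hq1.ne') _ (L.smul_mem _ hwL) ih
  -- Commuting `∂` past powers of `q` gives `q^j ∂^j w = (-1)^j j! (q')^j w`; the constant is
  -- nonzero in characteristic `0`.
  have hkey : ∀ j, ∃ c : k, c ≠ 0 ∧
      polyX (q ^ j) • d k ^ j • w = polyX (C c * derivative q ^ j) • w := by
    intro j
    induction j with
    | zero => exact ⟨1, one_ne_zero, by simp⟩
    | succ j ih =>
      obtain ⟨c, hc, ih⟩ := ih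
      have h1 : polyX (q ^ (j + 1)) • d k ^ j • w = 0 := by
        rw [pow_succ', map_mul, mul_smul, ih, smul_smul, ← map_mul, mul_comm, map_mul, mul_smul,
          hqw, smul_zero]
      refine ⟨-((j : k) + 1) * c, mul_ne_zero (neg_ne_zero.2 (Nat.cast_add_one_ne_zero j)) hc, ?_⟩
      have h2 : polyX (q ^ (j + 1)) * d k =
          d k * polyX (q ^ (j + 1)) - polyX (C ((j : k) + 1) * derivative q) * polyX (q ^ j) := by
        rw [d_mul_polyX, ← map_mul, derivative_pow_succ, mul_right_comm]
        simp
      rw [pow_succ' (d k), mul_smul, smul_smul, h2, sub_smul, mul_smul, h1, smul_zero, zero_sub, mul_smul,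
        ih, smul_smul, ← map_mul, ← neg_smul, ← map_neg]
      congr 2
      simp only [C_neg, C_mul]
      ring
  obtain ⟨r, hr⟩ := Submodule.mem_span_singleton.1 hwL
  obtain ⟨h', r', hh', hr'⟩ := isLocallyPrincipal_polyD.left_ore r hh
  have hhw : polyD h' • w = 0 := by
    have hr'' : polyD h' * r = r' * polyD h := hr'
    rw [← hr, smul_smul, hr'', mul_smul, hhv, smul_zero]
  have h3 : ∀ i < h'.natDegree, polyX (q ^ h'.natDegree) • d k ^ i • w = 0 := by
    intro i hi
    obtain ⟨j, hj⟩ : ∃ j, h'.natDegree = j + 1 + i := ⟨h'.natDegree - 1 - i, by omega⟩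
    obtain ⟨c, -, hc⟩ := hkey i
    rw [hj, pow_add, map_mul, mul_smul, hc, smul_smul, ← map_mul, pow_succ,
      show q ^ j * q * (C c * derivative q ^ i) = q ^ j * (C c * derivative q ^ i) * q by ring,
      map_mul, mul_smul, hqw, smul_zero]
  obtain ⟨c, hc, hcw⟩ := hkey h'.natDegree
  -- With `n = deg h'`, `q^n` kills `∂^i w` for `i < n`. Only the top term of `h'(∂) w` survives,
  -- and it is a nonzero multiple of `(q')^n w`, although `h'(∂) w = 0`.
  have h4 : polyX (q ^ h'.natDegree) • polyD h' • w =
      polyX (C (h'.leadingCoeff * c)) • polyX (derivative q ^ h'.natDegree) • w := by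
    rw [polyD_eq_sum, Finset.sum_smul, Finset.smul_sum, Finset.sum_range_succ,
      Finset.sum_eq_zero, zero_add, mul_smul, smul_smul, ← map_mul, mul_comm, map_mul, mul_smul,
      hcw, smul_smul, smul_smul, ← map_mul, ← map_mul, C_mul, mul_assoc]
    · rfl
    · intro i hi
      rw [mul_smul, smul_smul, ← map_mul, mul_comm, map_mul, mul_smul, h3 i (Finset.mem_range.1 hi),
        smul_zero]
  rw [hhw, smul_zero, eq_comm] at h4
  exact hpow _ (hC _ (mul_ne_zero (leadingCoeff_ne_zero.2 hh') hc) _ h4)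

/-- The class of `1` modulo the left ideal generated by `p(x)` and `h(∂)` is killed by both, hence
zero. -/
theorem exists_mul_polyX_add_mul_polyD {p h : k[X]} (hp : p ≠ 0) (hh : h ≠ 0) :
    ∃ u v, u * polyX p + v * polyD h = 1 := by
  let I : Ideal (WeylRing k) := Ideal.span {polyX p, polyD h}
  have h1 : (Submodule.Quotient.mk 1 : WeylRing k ⧸ I) = 0 := by
    refine eq_zero_of_polyX_smul_of_polyD_smul hp hh ?_ ?_ <;>
    · rw [← Submodule.Quotient.mk_smul, Submodule.Quotient.mk_eq_zero, smul_eq_mul, mul_one]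
      exact Ideal.subset_span (by simp)
  rw [Submodule.Quotient.mk_eq_zero] at h1
  exact Ideal.mem_span_pair.1 h1

theorem exists_polyX_mul_add_polyD_mul {p h : k[X]} (hp : p ≠ 0) (hh : h ≠ 0) :
    ∃ u v, polyX p * u + polyD h * v = 1 := by
  have hh' : h.comp (-X) ≠ 0 := fun h0 => hh (by
    have := congrArg (fun f => f.comp (-X)) h0
    simpa [comp_assoc] using this)
  obtain ⟨u, v, huv⟩ := exists_mul_polyX_add_mul_polyD hp hh'
  refine ⟨(opHom u).unop, (opHom v).unop, ?_⟩
  have := congrArg (fun r => (opHom r).unop) huv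
  simpa [opHom_polyX, opHom_polyD, comp_assoc] using this

theorem exists_strictAnti : ∃ δ : Ideal (WeylRing k) → ℕ,
    ∀ I J : Ideal (WeylRing k), I ≠ ⊥ → I < J → δ J < δ I :=
  isLocallyPrincipal_polyX.exists_strictAnti isLocallyPrincipal_polyD
    fun _ _ => exists_mul_polyX_add_mul_polyD

theorem exists_strictAnti_op : ∃ δ : Ideal (WeylRing k)ᵐᵒᵖ → ℕ,
    ∀ I J : Ideal (WeylRing k)ᵐᵒᵖ, I ≠ ⊥ → I < J → δ J < δ I := by
  obtain ⟨δ, hδ⟩ := exists_strictAnti (k := k)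
  let e : WeylRing k →+* (WeylRing k)ᵐᵒᵖ := (opEquiv : WeylRing k ≃+* _)
  have he : Function.Surjective e := opEquiv.surjective
  refine ⟨fun I => δ (I.comap e), fun I J hI hIJ => hδ _ _ (fun h => hI ?_) ?_⟩
  · rw [← Ideal.map_comap_of_surjective e he I, h, Ideal.map_bot]
  · refine lt_of_le_of_ne (Ideal.comap_mono hIJ.le) fun h => hIJ.ne ?_
    exact Ideal.comap_injective_of_surjective e he h

instance : IsNoetherianRing (WeylRing k) :=
  isNoetherianRing_of_strictAnti exists_strictAnti.choose_spec

instance : IsNoetherianRing (WeylRing k)ᵐᵒᵖ :=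
  isNoetherianRing_of_strictAnti exists_strictAnti_op.choose_spec

theorem hasArtinianQuotients : HasArtinianQuotients (WeylRing k) :=
  hasArtinianQuotients_of_strictAnti exists_strictAnti.choose_spec

theorem hasArtinianQuotients_op : HasArtinianQuotients (WeylRing k)ᵐᵒᵖ :=
  hasArtinianQuotients_of_strictAnti exists_strictAnti_op.choose_spec

instance : IsSimpleRing (WeylRing k) := by
  -- The commutator with `∂` differentiates `p`, so repeated use reaches a nonzero constant in `J`.
  have hpoly : ∀ (J : TwoSidedIdeal (WeylRing k)) (p : k[X]), p ≠ 0 → polyX p ∈ J → 1 ∈ J := by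
    intro J p hp hpJ
    induction hn : p.natDegree using Nat.strong_induction_on generalizing p with
    | _ n ih =>
    by_cases h0 : p.natDegree = 0
    · rw [eq_C_of_natDegree_eq_zero h0] at hp hpJ
      have := J.mul_mem_left (polyX (C (p.coeff 0)⁻¹)) _ hpJ
      rwa [← map_mul, ← C_mul, inv_mul_cancel₀ (by simpa using hp), C_1, map_one] at this
    · refine ih _ (hn ▸ natDegree_derivative_lt h0) (derivative p)
        (fun h => h0 (derivative_eq_zero.1 h)) ?_ rfl
      have := J.sub_mem (J.mul_mem_left (d k) _ hpJ) (J.mul_mem_right _ (d k) hpJ)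
      rwa [d_mul_polyX, add_sub_cancel_left] at this
  have htop : ∀ J : TwoSidedIdeal (WeylRing k), J = ⊥ ∨ J = ⊤ := by
    intro J
    refine or_iff_not_imp_left.2 fun hJ => ?_
    have hJ' : J.asIdeal ≠ ⊥ := fun h => hJ (by
      refine eq_bot_iff.2 fun r hr => ?_
      have : r ∈ J.asIdeal := TwoSidedIdeal.mem_asIdeal.2 hr
      rw [h] at this
      exact this)
    obtain ⟨g, hg, hg0, hmin⟩ := exists_natDegree_le J.asIdeal hJ'
    rw [TwoSidedIdeal.mem_asIdeal] at hg
    -- The commutator with `x` differentiates in `∂`, so an element of `J` of least degree has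
    -- degree `0`, that is, lies in `k[x]`.
    have hcomm : symbol (g * x k - x k * g) = derivative (symbol g) := by
      rw [mul_x_sub_x_mul, symbol_ofSymbol]
    have hmem : g * x k - x k * g ∈ J :=
      J.sub_mem (J.mul_mem_right _ _ hg) (J.mul_mem_left _ _ hg)
    have h0 : (symbol g).natDegree = 0 := by
      by_contra h0
      have hne : derivative (symbol g) ≠ 0 := fun h => h0 (derivative_eq_zero.1 h)
      have := hmin _ (TwoSidedIdeal.mem_asIdeal.2 hmem) fun h => hne (by rw [← hcomm, h, map_zero])
      rw [hcomm] at this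
      exact this.not_gt (natDegree_derivative_lt h0)
    have hgp : polyX ((symbol g).coeff 0) = g := by
      rw [← ofSymbol_symbol (polyX _), symbol_polyX, ← eq_C_of_natDegree_eq_zero h0,
        ofSymbol_symbol]
    rw [← hgp] at hg hg0
    have h1 := hpoly J _ (fun h => hg0 (by rw [h, map_zero])) hg
    refine eq_top_iff.2 fun r _ => ?_
    simpa using J.mul_mem_left r _ h1
  have : Nontrivial (TwoSidedIdeal (WeylRing k)) := ⟨⊥, ⊤, fun h => by
    have h1 : (1 : WeylRing k) ∈ (⊥ : TwoSidedIdeal (WeylRing k)) := by rw [h]; trivial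
    exact one_ne_zero ((TwoSidedIdeal.mem_bot _).1 h1)⟩
  exact ⟨⟨htop⟩⟩

end WeylRing

end WeylLocal

/-! ### Projectivity of left ideals by gluing local splittings. -/

section Projectivity

variable {R : Type u} [Ring R]

/-- Two projective modules with the same image in a module: if one kernel is projective, then so is
the other. -/
theorem projective_ker_of_projective_ker {F₁ : Type v} {F₂ : Type w} {M : Type*} [AddCommGroup F₁]
    [Module R F₁] [AddCommGroup F₂] [Module R F₂] [AddCommGroup M] [Module R M]
    [Module.Projective R F₁] [Module.Projective R F₂] {p₁ : F₁ →ₗ[R] M} {p₂ : F₂ →ₗ[R] M}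
    (h : LinearMap.range p₁ = LinearMap.range p₂) [Module.Projective R (LinearMap.ker p₂)] :
    Module.Projective R (LinearMap.ker p₁) := by
  obtain ⟨s, hs⟩ := Module.projective_lifting_property p₂.rangeRestrict
    (p₁.codRestrict _ fun u => h ▸ p₁.mem_range_self u) p₂.surjective_rangeRestrict
  obtain ⟨t, ht⟩ := Module.projective_lifting_property p₁.rangeRestrict
    (p₂.codRestrict _ fun u => h ▸ p₂.mem_range_self u) p₁.surjective_rangeRestrict
  have hs' : ∀ u, p₂ (s u) = p₁ u := fun u => congrArg Subtype.val (LinearMap.congr_fun hs u)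
  have ht' : ∀ u, p₁ (t u) = p₂ u := fun u => congrArg Subtype.val (LinearMap.congr_fun ht u)
  -- Schanuel's argument: `α z = (-s z, z)` and `β (y, u) = -t y + u - t (s u)` exhibit `ker p₁` as
  -- a retract of `ker p₂ × F₁`.
  let α : LinearMap.ker p₁ →ₗ[R] LinearMap.ker p₂ × F₁ :=
    (LinearMap.codRestrict _ (-(s ∘ₗ (LinearMap.ker p₁).subtype)) fun z => by
      simp [hs']).prod (LinearMap.ker p₁).subtype
  let β : LinearMap.ker p₂ × F₁ →ₗ[R] LinearMap.ker p₁ :=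
    LinearMap.codRestrict _ (LinearMap.coprod (-(t ∘ₗ (LinearMap.ker p₂).subtype))
      (LinearMap.id - t ∘ₗ s)) fun y => by simp [hs', ht']
  refine Module.Projective.of_split α β (LinearMap.ext fun z => Subtype.ext ?_)
  change -t (-s z) + ((z : F₁) - t (s z)) = z
  rw [map_neg, neg_neg, add_sub_cancel]

namespace IsLocallyPrincipal

variable {A : Type v} [CommRing A] [IsDomain A] {P : A →+* R}

theorem exists_common_left (hP : IsLocallyPrincipal P) {n : ℕ} (z : Fin n → R)
    {p : Fin n → A} (hp : ∀ j, p j ≠ 0) :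
    ∃ (q : A) (t : Fin n → R), q ≠ 0 ∧ ∀ j, P q * z j = t j * P (p j) := by
  choose q t hq h using fun j => hP.left_ore (z j) (hp j)
  refine ⟨∏ j, q j, fun j => P (∏ i ∈ Finset.univ.erase j, q i) * t j,
    Finset.prod_ne_zero_iff.2 fun j _ => hq j, fun j => ?_⟩
  rw [← Finset.prod_erase_mul _ _ (Finset.mem_univ j), map_mul, mul_assoc, h, mul_assoc]

theorem exists_common_right (hP : IsLocallyPrincipal P) {n : ℕ} (z : Fin n → R)
    {p : Fin n → A} (hp : ∀ j, p j ≠ 0) :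
    ∃ (q : A) (t : Fin n → R), q ≠ 0 ∧ ∀ j, z j * P q = P (p j) * t j := by
  choose q t hq h using fun j => hP.right_ore (z j) (hp j)
  refine ⟨∏ j, q j, fun j => t j * P (∏ i ∈ Finset.univ.erase j, q i),
    Finset.prod_ne_zero_iff.2 fun j _ => hq j, fun j => ?_⟩
  rw [← Finset.mul_prod_erase _ _ (Finset.mem_univ j), map_mul, ← mul_assoc, h, mul_assoc]

/-- A linear form on the module of relations of a left ideal extends after localization. -/
theorem exists_extension (hP : IsLocallyPrincipal P) [IsDomain R] {n : ℕ}
    {p : (Fin n → R) →ₗ[R] R} (hp : LinearMap.range p ≠ ⊥) (φ : LinearMap.ker p →ₗ[R] R) :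
    ∃ (s : A) (ψ : (Fin n → R) →ₗ[R] R), s ≠ 0 ∧ ∀ z : LinearMap.ker p, ψ z = φ z * P s := by
  obtain ⟨_, ⟨γ, rfl⟩, hg0, hg⟩ := hP.exists_generator (LinearMap.range p) hp
  choose c hc h using fun j => hg (p (Pi.single j 1)) ⟨_, rfl⟩
  choose r hr using fun j => Ideal.mem_span_singleton'.1 (h j)
  -- Locally the image of `p` is free on `p γ`, and the elements `P(c j)⁻¹ z j` are the projections
  -- of the basis vectors to the kernel along `γ`. Hence `φ` extends once denominators are cleared
  -- by `s` on the right.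
  let z : Fin n → LinearMap.ker p := fun j => ⟨P (c j) • Pi.single j 1 - r j • γ, by
    rw [LinearMap.mem_ker, map_sub, map_smul, map_smul, smul_eq_mul, smul_eq_mul, hr, sub_self]⟩
  obtain ⟨s, t, hs, ht⟩ := hP.exists_common_right (fun j => φ (z j)) hc
  refine ⟨s, Fintype.linearCombination R t, hs, fun y => ?_⟩
  obtain ⟨q, v, hq, hv⟩ := hP.exists_common_left (fun j => (y : Fin n → R) j) hc
  have hP0 : ∀ {a : A}, a ≠ 0 → P a ≠ 0 := fun ha h0 =>
    ha (hP.injective (by rw [h0, map_zero]))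
  have hy : P q • (y : Fin n → R) - ∑ j, v j • (z j : Fin n → R) = (∑ j, v j * r j) • γ := by
    have h1 : P q • (y : Fin n → R) = ∑ j, v j • P (c j) • Pi.single j (1 : R) := by
      ext i
      simp [Finset.sum_apply, Pi.single_apply, hv]
    rw [h1, ← Finset.sum_sub_distrib, Finset.sum_smul]
    refine Finset.sum_congr rfl fun j _ => ?_
    simp only [z, smul_sub, mul_smul, sub_sub_cancel]
  -- Applying `p` to `hy` leaves this coefficient times `p γ ≠ 0`.
  have h0 : ∑ j, v j * r j = 0 := by
    have := congrArg p hy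
    rw [map_sub, map_smul, map_sum, map_smul, LinearMap.mem_ker.1 y.2,
      Finset.sum_eq_zero fun j _ => by rw [map_smul, LinearMap.mem_ker.1 (z j).2, smul_zero],
      smul_zero, sub_zero, eq_comm, smul_eq_mul, mul_eq_zero] at this
    exact this.resolve_right hg0
  have hy' : P q • y = ∑ j, v j • z j := by
    refine Subtype.ext ?_
    rw [h0, zero_smul, sub_eq_zero] at hy
    rw [Submodule.coe_smul, hy, Submodule.coe_sum]
    rfl
  have hφ : P q * φ y = ∑ j, v j * φ (z j) := by
    rw [← smul_eq_mul, ← map_smul, hy', map_sum]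
    simp only [map_smul, smul_eq_mul]
  refine mul_left_cancel₀ (hP0 hq) ?_
  rw [← mul_assoc, hφ, Finset.sum_mul, Fintype.linearCombination_apply, Finset.mul_sum]
  refine Finset.sum_congr rfl fun j _ => ?_
  rw [mul_assoc, ht, smul_eq_mul, ← mul_assoc, ← mul_assoc, hv]

/-- A left ideal of projective dimension at most one is projective if the ring is locally a
principal ideal ring with respect to two comaximal Ore sets. -/
theorem projective (hP : IsLocallyPrincipal P) {B : Type v} [CommRing B] [IsDomain B]
    {Q : B →+* R} (hQ : IsLocallyPrincipal Q) [IsDomain R] [IsNoetherianRing R]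
    (hPQ : ∀ p q, p ≠ 0 → q ≠ 0 → ∃ u v, P p * u + Q q * v = 1) {n : ℕ}
    {p : (Fin n → R) →ₗ[R] R} (hp : LinearMap.range p ≠ ⊥)
    [Module.Projective R (LinearMap.ker p)] : Module.Projective R (LinearMap.range p) := by
  have : IsNoetherian R (Fin n → R) := isNoetherian_of_isNoetherianRing_of_finite _ _
  have hfin : Module.Finite R (LinearMap.ker p) := Module.Finite.of_fg (IsNoetherian.noetherian _)
  -- The two local extensions restrict to `φ` times `P s` and `φ` times `Q t`; the relation `P s * u
  -- + Q t * v = 1` combines them into an extension of `φ`. Extending a dual basis of the kernel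
  -- then yields a retraction onto it.
  have hext : ∀ φ : LinearMap.ker p →ₗ[R] R, ∃ ψ : (Fin n → R) →ₗ[R] R,
      ∀ z : LinearMap.ker p, ψ z = φ z := by
    intro φ
    obtain ⟨s, ψ, hs, hψ⟩ := hP.exists_extension hp φ
    obtain ⟨t, χ, ht, hχ⟩ := hQ.exists_extension hp φ
    obtain ⟨u, v, huv⟩ := hPQ s t hs ht
    refine ⟨LinearMap.toSpanSingleton R R u ∘ₗ ψ + LinearMap.toSpanSingleton R R v ∘ₗ χ,
      fun z => ?_⟩
    simp only [LinearMap.add_apply, LinearMap.comp_apply, LinearMap.toSpanSingleton_apply,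
      smul_eq_mul, hψ, hχ, mul_assoc]
    rw [← mul_add, huv, mul_one]
  obtain ⟨m, q, c, hqc⟩ := Module.Projective.exists_dual_basis (R := R) (P := LinearMap.ker p)
  choose ψ hψ using fun j => hext (q j)
  let ρ : (Fin n → R) →ₗ[R] LinearMap.ker p :=
    ∑ j, LinearMap.toSpanSingleton R _ (c j) ∘ₗ ψ j
  have hρ : ∀ z : LinearMap.ker p, ρ z = z := by
    intro z
    simpa [ρ, LinearMap.sum_apply, hψ] using hqc z
  obtain ⟨s, hs⟩ := LinearMap.exists_comp_eq_of_ker_le p.surjective_rangeRestrict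
    (h := LinearMap.id - (LinearMap.ker p).subtype ∘ₗ ρ) (by
      intro z hz
      have hz' : z ∈ LinearMap.ker p := by rwa [LinearMap.ker_rangeRestrict] at hz
      have := congrArg Subtype.val (hρ ⟨z, hz'⟩)
      simpa [sub_eq_zero] using this.symm)
  refine Module.Projective.of_split s p.rangeRestrict (LinearMap.ext fun y => ?_)
  obtain ⟨x, rfl⟩ := p.surjective_rangeRestrict y
  rw [LinearMap.comp_apply, hs]
  ext
  simp

end IsLocallyPrincipal

end Projectivity

/-! ### Left ideals of the Weyl algebra: resolutions of length one and heredity. -/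

section WeylHereditary

open Polynomial

namespace WeylRing

variable {k : Type u} [Field k]

/-- The degrees in `∂` of the nonzero elements of a left ideal. -/
def Degrees (I : Ideal (WeylRing k)) : Type :=
  {n : ℕ // ∃ a ∈ I, a ≠ 0 ∧ (symbol a).natDegree = n}

noncomputable instance (I : Ideal (WeylRing k)) : LinearOrder (Degrees I) :=
  inferInstanceAs (LinearOrder {n : ℕ // ∃ a ∈ I, a ≠ 0 ∧ (symbol a).natDegree = n})

/-- The leading coefficients of degree `n` of a left ideal form an ideal. -/
noncomputable def leadingCoeffs (I : Ideal (WeylRing k)) (n : ℕ) : Ideal k[X] where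
  carrier := {c | ∃ a ∈ I, (symbol a).natDegree ≤ n ∧ (symbol a).coeff n = c}
  zero_mem' := ⟨0, I.zero_mem, by simp, by simp⟩
  add_mem' := by
    rintro _ _ ⟨a, ha, han, rfl⟩ ⟨b, hb, hbn, rfl⟩
    exact ⟨a + b, I.add_mem ha hb, by
      rw [map_add]; exact (natDegree_add_le _ _).trans (max_le han hbn), by simp⟩
  smul_mem' := by
    rintro c _ ⟨a, ha, han, rfl⟩
    exact ⟨polyX c * a, I.mul_mem_left _ ha, by
      rw [symbol_polyX_mul]; exact (natDegree_C_mul_le _ _).trans han, by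
      rw [symbol_polyX_mul, coeff_C_mul, smul_eq_mul]⟩

theorem exists_leading_basis (I : Ideal (WeylRing k)) (n : Degrees I) :
    ∃ b ∈ I, b ≠ 0 ∧ (symbol b).natDegree = n.1 ∧
      ∀ a ∈ I, (symbol a).natDegree = n.1 → (symbol b).leadingCoeff ∣ (symbol a).leadingCoeff := by
  obtain ⟨n, a, ha, ha0, han⟩ := n
  obtain ⟨c, hc⟩ := IsPrincipalIdealRing.principal (leadingCoeffs I n)
  obtain ⟨b, hb, hbn, hbc⟩ : c ∈ leadingCoeffs I n := hc ▸ Submodule.mem_span_singleton_self c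
  have hdvd : ∀ a ∈ I, (symbol a).natDegree = n → c ∣ (symbol a).leadingCoeff := by
    intro a ha han
    have : (symbol a).leadingCoeff ∈ leadingCoeffs I n := ⟨a, ha, han.le, by rw [← han]; rfl⟩
    rw [hc] at this
    exact Ideal.mem_span_singleton.1 this
  have hc0 : c ≠ 0 := by
    rintro rfl
    have := hdvd a ha han
    rw [zero_dvd_iff, leadingCoeff_eq_zero, symbol_eq_zero_iff] at this
    exact ha0 this
  have hbn' : (symbol b).natDegree = n :=
    le_antisymm hbn (le_natDegree_of_ne_zero (by rwa [hbc]))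
  refine ⟨b, hb, ?_, hbn', ?_⟩
  · rintro rfl
    simp at hbc
    exact hc0 hbc.symm
  · rw [leadingCoeff, hbn', hbc]
    exact hdvd

/-- A basis over `k[x]` of a left ideal of the Weyl algebra. -/
noncomputable def leadingBasis (I : Ideal (WeylRing k)) (n : Degrees I) : WeylRing k :=
  (exists_leading_basis I n).choose

variable (I : Ideal (WeylRing k))

theorem leadingBasis_mem (n : Degrees I) : leadingBasis I n ∈ I :=
  (exists_leading_basis I n).choose_spec.1

theorem leadingBasis_ne_zero (n : Degrees I) : leadingBasis I n ≠ 0 :=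
  (exists_leading_basis I n).choose_spec.2.1

theorem natDegree_leadingBasis (n : Degrees I) : (symbol (leadingBasis I n)).natDegree = n.1 :=
  (exists_leading_basis I n).choose_spec.2.2.1

theorem leadingCoeff_leadingBasis_dvd (n : Degrees I) {a : WeylRing k} (ha : a ∈ I)
    (han : (symbol a).natDegree = n.1) :
    (symbol (leadingBasis I n)).leadingCoeff ∣ (symbol a).leadingCoeff :=
  (exists_leading_basis I n).choose_spec.2.2.2 a ha han

/-- Families of polynomials in `x` inside the free module over the Weyl algebra. -/
noncomputable def polyFinsupp {ι : Type v} : (ι →₀ k[X]) →+ (ι →₀ WeylRing k) :=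
  Finsupp.mapRange.addMonoidHom (polyX (k := k)).toRingHom.toAddMonoidHom

@[simp]
theorem polyFinsupp_apply {ι : Type v} (q : ι →₀ k[X]) (i : ι) :
    polyFinsupp q i = polyX (q i) := rfl

@[simp]
theorem polyFinsupp_single {ι : Type v} (i : ι) (p : k[X]) :
    polyFinsupp (Finsupp.single i p) = Finsupp.single i (polyX p) :=
  Finsupp.mapRange_single (hf := map_zero _)

/-- The map from the free module on the `k[x]`-basis of a left ideal. -/
noncomputable abbrev leadingMap : (Degrees I →₀ WeylRing k) →ₗ[WeylRing k] WeylRing k :=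
  Finsupp.linearCombination (WeylRing k) (leadingBasis I)

theorem exists_leadingMap_polyFinsupp_eq {a : WeylRing k} (ha : a ∈ I) :
    ∃ q, leadingMap I (polyFinsupp q) = a := by
  induction hn : (symbol a).natDegree using Nat.strong_induction_on generalizing a with
  | _ n ih =>
  by_cases ha0 : a = 0
  · exact ⟨0, by simp [ha0]⟩
  let m : Degrees I := ⟨n, a, ha, ha0, hn⟩
  obtain ⟨e, he⟩ := leadingCoeff_leadingBasis_dvd I m ha hn
  let b := a - polyX e * leadingBasis I m
  have hb : b ∈ I := I.sub_mem ha (I.mul_mem_left _ (leadingBasis_mem I m))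
  have hsb : symbol b = symbol a - C e * symbol (leadingBasis I m) := by
    rw [map_sub, symbol_polyX_mul]
  obtain ⟨q, hq⟩ : ∃ q, leadingMap I (polyFinsupp q) = b := by
    by_cases hb0 : b = 0
    · exact ⟨0, by simp [hb0]⟩
    refine ih _ ?_ hb rfl
    have hle : (symbol b).natDegree ≤ n := by
      rw [hsb]
      exact (natDegree_sub_le _ _).trans (max_le hn.le
        ((natDegree_C_mul_le _ _).trans (natDegree_leadingBasis I m).le))
    refine lt_of_le_of_ne hle fun hbn => hb0 ?_
    rw [← symbol_eq_zero_iff, ← leadingCoeff_eq_zero, leadingCoeff, hbn, hsb, coeff_sub,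
      coeff_C_mul, sub_eq_zero]
    have h1 : (symbol a).coeff n = (symbol a).leadingCoeff := by rw [← hn]; rfl
    have h2 : (symbol (leadingBasis I m)).coeff n = (symbol (leadingBasis I m)).leadingCoeff := by
      rw [leadingCoeff, natDegree_leadingBasis I m]
    rw [h1, h2, he, mul_comm]
  refine ⟨q + Finsupp.single m e, ?_⟩
  rw [map_add, map_add, hq, polyFinsupp_single, Finsupp.linearCombination_single, smul_eq_mul]
  exact sub_add_cancel _ _

/-- The basis elements have pairwise distinct degrees in `∂`, so the term of highest degree cannot
cancel. -/
theorem eq_zero_of_leadingMap_polyFinsupp_eq_zero {q : Degrees I →₀ k[X]}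
    (hq : leadingMap I (polyFinsupp q) = 0) : q = 0 := by
  by_contra hq0
  have hne : q.support.Nonempty := Finsupp.support_nonempty_iff.2 hq0
  let n := q.support.max' hne
  have hn : n ∈ q.support := Finset.max'_mem _ _
  have hsum : leadingMap I (polyFinsupp q) = ∑ j ∈ q.support, polyX (q j) * leadingBasis I j := by
    rw [Finsupp.linearCombination_apply, Finsupp.sum_of_support_subset _ (s := q.support)]
    · rfl
    · intro j hj
      rw [Finsupp.mem_support_iff] at hj ⊢
      intro h
      exact hj (by rw [polyFinsupp_apply, h, map_zero])
    · intro i _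
      exact zero_smul _ _
  have h1 := congrArg (fun r => (symbol r).coeff n.1) (hsum.symm.trans hq)
  simp only [map_sum, finsetSum_coeff, symbol_polyX_mul, coeff_C_mul, map_zero, coeff_zero] at h1
  rw [Finset.sum_eq_single_of_mem n hn] at h1
  · rw [← natDegree_leadingBasis I n, coeff_natDegree, mul_eq_zero, leadingCoeff_eq_zero,
      symbol_eq_zero_iff] at h1
    exact h1.elim (Finsupp.mem_support_iff.1 hn) (leadingBasis_ne_zero I n)
  · intro j hj hjn
    have hlt : j < n := lt_of_le_of_ne (Finset.le_max' _ _ hj) hjn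
    rw [coeff_eq_zero_of_natDegree_lt (by rw [natDegree_leadingBasis]; exact hlt), mul_zero]

theorem range_leadingMap : LinearMap.range (leadingMap I) = I := by
  refine le_antisymm ?_ fun a ha => ?_
  · rw [Finsupp.range_linearCombination, Submodule.span_le]
    rintro _ ⟨n, rfl⟩
    exact leadingBasis_mem I n
  · obtain ⟨q, hq⟩ := exists_leadingMap_polyFinsupp_eq I ha
    exact ⟨_, hq⟩

/-- The kernel of the map from the free module on the `k[x]`-basis of a left ideal is free on the
relations that express the action of `∂`. -/
theorem projective_ker_leadingMap :
    Module.Projective (WeylRing k) (LinearMap.ker (leadingMap I)) := by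
  classical
  -- Expanding `∂ b_j` in the `k[x]`-basis of `I` gives one relation `ρ j` for each basis element.
  choose f hf using fun j => exists_leadingMap_polyFinsupp_eq I
    (I.mul_mem_left (d k) (leadingBasis_mem I j))
  let ρ : Degrees I → Degrees I →₀ WeylRing k := fun j => Finsupp.single j (d k) - polyFinsupp (f j)
  let Φ : (Degrees I →₀ WeylRing k) →ₗ[WeylRing k] (Degrees I →₀ WeylRing k) :=
    Finsupp.linearCombination (WeylRing k) ρ
  have hΦ : ∀ j, Φ (Finsupp.single j 1) = ρ j := fun j => by simp [Φ]
  have hΦker : ∀ t, leadingMap I (Φ t) = 0 := by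
    intro t
    have : leadingMap I ∘ₗ Φ = 0 := by
      refine Finsupp.lhom_ext' fun j => LinearMap.ext_ring ?_
      change leadingMap I (Φ (Finsupp.single j 1)) = 0
      rw [hΦ, map_sub, hf, Finsupp.linearCombination_single, smul_eq_mul, sub_self]
    exact LinearMap.congr_fun this t
  have hinj : Function.Injective Φ := by
    refine (injective_iff_map_eq_zero Φ).2 fun t ht => ?_
    by_contra ht0
    obtain ⟨l, hl, hmax⟩ := t.support.exists_max_image (fun j => (symbol (t j)).natDegree)
      (Finsupp.support_nonempty_iff.2 ht0)
    -- Here `t l` has maximal degree `N` in `∂` among the coefficients. The left side has degree `N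
    -- + 1`, the right side at most `N`.
    have h1 : t l * d k = ∑ j ∈ t.support, t j * polyX (f j l) := by
      have := DFunLike.congr_fun ht l
      simp only [Φ, Finsupp.linearCombination_apply, Finsupp.sum, Finsupp.finsetSum_apply, ρ,
        smul_sub, Finsupp.sub_apply, Finsupp.smul_apply, Finsupp.single_apply, polyFinsupp_apply,
        smul_eq_mul, Finset.sum_sub_distrib, mul_ite, mul_zero, Finset.sum_ite_eq', hl, if_true,
        Finsupp.zero_apply] at this
      exact sub_eq_zero.1 this
    set N := (symbol (t l)).natDegree
    have h2 : (symbol (t l * d k)).coeff (N + 1) = (symbol (t l)).leadingCoeff := by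
      have hd : symbol (d k) = X := by simpa using symbol_d_pow (k := k) 1
      rw [(natDegree_symbol_mul_le (n := N) (m := 1) le_rfl
        (by rw [hd]; exact natDegree_X_le)).2, hd, coeff_X_one, mul_one]
      rfl
    have h3 : (symbol (t l * d k)).natDegree ≤ N := by
      rw [h1, map_sum]
      refine natDegree_sum_le_of_forall_le _ _ fun j hj => ?_
      exact (natDegree_symbol_mul_le (m := 0) (hmax j hj)
        (by rw [symbol_polyX, natDegree_C])).1
    rw [coeff_eq_zero_of_natDegree_lt (by omega), eq_comm, leadingCoeff_eq_zero,
      symbol_eq_zero_iff] at h2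
    exact Finsupp.mem_support_iff.1 hl h2
  -- Modulo the relations `∂` can be rewritten away, so every element is a relation plus a family of
  -- polynomials in `x`. On such families `leadingMap` is injective, so an element of the kernel is
  -- a relation.
  let T : AddSubgroup (Degrees I →₀ WeylRing k) :=
    (LinearMap.range Φ).toAddSubgroup ⊔ (polyFinsupp (k := k) (ι := Degrees I)).range
  have hTΦ : ∀ t, Φ t ∈ T := fun t => AddSubgroup.mem_sup_left ⟨t, rfl⟩
  have hTp : ∀ q, polyFinsupp q ∈ T := fun q => AddSubgroup.mem_sup_right ⟨q, rfl⟩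
  have hsmul : ∀ (r : WeylRing k), (∀ q, r • polyFinsupp q ∈ T) → ∀ u ∈ T, r • u ∈ T := by
    rintro r hr u hu
    obtain ⟨_, ⟨t, rfl⟩, _, ⟨q, rfl⟩, rfl⟩ := AddSubgroup.mem_sup.1 hu
    rw [smul_add, ← map_smul]
    exact T.add_mem (hTΦ _) (hr q)
  let A : Subring (WeylRing k) :=
    { carrier := {r | ∀ u ∈ T, r • u ∈ T}
      mul_mem' := fun ha hb u hu => by rw [mul_smul]; exact ha _ (hb u hu)
      one_mem' := fun u hu => by rwa [one_smul]
      add_mem' := fun ha hb u hu => by rw [add_smul]; exact T.add_mem (ha u hu) (hb u hu)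
      zero_mem' := fun u _ => by rw [zero_smul]; exact T.zero_mem
      neg_mem' := fun ha u hu => by rw [neg_smul]; exact T.neg_mem (ha u hu) }
  have hpoly : ∀ p : k[X], polyX p ∈ A := fun p => hsmul _ fun q => by
    have : polyX p • polyFinsupp q = polyFinsupp (p • q) := by
      ext i
      simp
    rw [this]
    exact hTp _
  have hA : ∀ r : WeylRing k, r ∈ A := mem_of_polyX_mem_of_d_mem hpoly <| hsmul _ fun q => by
    induction q using Finsupp.induction_linear with
    | zero => rw [map_zero, smul_zero]; exact T.zero_mem
    | add p q hp hq => rw [map_add, smul_add]; exact T.add_mem hp hq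
    | single i p =>
      have h1 : d k • polyFinsupp (Finsupp.single i p) =
          polyX p • (Φ (Finsupp.single i 1) + polyFinsupp (f i)) +
            polyFinsupp (Finsupp.single i (derivative p)) := by
        rw [hΦ, sub_add_cancel, polyFinsupp_single, polyFinsupp_single, Finsupp.smul_single,
          Finsupp.smul_single, ← Finsupp.single_add, smul_eq_mul, smul_eq_mul, d_mul_polyX]
      rw [h1]
      exact T.add_mem (hpoly p _ (T.add_mem (hTΦ _) (hTp _))) (hTp _)
  have hT : ∀ u, u ∈ T := by
    intro u
    induction u using Finsupp.induction_linear with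
    | zero => exact T.zero_mem
    | add u v hu hv => exact T.add_mem hu hv
    | single i r =>
      have h1 : Finsupp.single i r = r • polyFinsupp (Finsupp.single i 1) := by
        rw [polyFinsupp_single, Finsupp.smul_single, map_one, smul_eq_mul, mul_one]
      rw [h1]
      exact hA r _ (hTp _)
  have hker : LinearMap.ker (leadingMap I) = LinearMap.range Φ := by
    refine le_antisymm (fun u hu => ?_) ?_
    · obtain ⟨_, ⟨t, rfl⟩, _, ⟨q, rfl⟩, rfl⟩ := AddSubgroup.mem_sup.1 (hT u)
      have h1 : leadingMap I (polyFinsupp q) = 0 := by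
        have h2 : leadingMap I (Φ t + polyFinsupp q) = 0 := hu
        rwa [map_add, hΦker, zero_add] at h2
      rw [eq_zero_of_leadingMap_polyFinsupp_eq_zero I h1, map_zero, add_zero]
      exact ⟨t, rfl⟩
    · rintro _ ⟨t, rfl⟩
      exact hΦker t
  rw [hker]
  exact Module.Projective.of_equiv (LinearEquiv.ofInjective Φ hinj)

/-- The Weyl algebra over a field of characteristic zero is left hereditary. -/
theorem projective_ideal [CharZero k] : Module.Projective (WeylRing k) I := by
  by_cases hI : I = ⊥
  · subst hI
    infer_instance
  obtain ⟨n, a, ha⟩ := Submodule.fg_iff_exists_fin_generating_family.1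
    (IsNoetherian.noetherian (R := WeylRing k) I)
  let p : (Fin n → WeylRing k) →ₗ[WeylRing k] WeylRing k := Fintype.linearCombination _ a
  have hp : LinearMap.range p = I := by
    rw [← ha, Fintype.range_linearCombination]
  -- The `k[x]`-basis may be infinite, so Schanuel's argument transfers projectivity of the kernel
  -- to a presentation by finitely many generators.
  have := projective_ker_leadingMap I
  have : Module.Projective (WeylRing k) (LinearMap.ker p) :=
    projective_ker_of_projective_ker (hp.trans (range_leadingMap I).symm)
  have := isLocallyPrincipal_polyX.projective isLocallyPrincipal_polyD
    (fun _ _ => exists_polyX_mul_add_polyD_mul) (p := p) (by rwa [hp])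
  rwa [hp] at this

theorem isRDRing [CharZero k] : IsRDRing.{u, w} (WeylRing k) :=
  isRDRing_of_isSimpleRing hasArtinianQuotients hasArtinianQuotients_op fun I => projective_ideal I

end WeylRing

end WeylHereditary

theorem mainTheorem6 :
    (∀ (R : Type u) [Ring R] [IsDomain R], IsRDRing.{u, max u v} R →
      ∀ (N : Type (max u v)) [AddCommGroup N] [Module R N], IsPureInjective R N →
        Module.Injective R (ulm R N) ∧
        (∃ Nr : Submodule R N, IsCompl (ulm R N) Nr ∧ ulm R Nr = ⊥) ∧
        ulm R N = lastUlm R N ∧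
        IsGreatest {U : Submodule R N | Module.Injective R U} (ulm R N)) ∧
    (∀ (k : Type u) [Field k] [CharZero k],
      IsDomain (WeylAlgebra k) ∧ IsRDRing.{u, max u v} (WeylAlgebra k)) := by
  refine ⟨fun R _ _ hR N _ _ hN => ulm_of_isPureInjective hR N hN, fun k _ _ => ⟨?_, ?_⟩⟩
  · exact inferInstanceAs (IsDomain (WeylRing k))
  · exact WeylRing.isRDRing (k := k)
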